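/- Let $\mathbb K$ be a quadratically closed field, i.e. a field of characteristic $\neq 2$ in which every element is a square, and fix $i\in\mathbb K$ with $i^2=-1$. Let $n\ge 1$, $F=\mathbb K((t))$, $A=\mathbb K[[t]]$, $G=\mathrm{SL}_n(F)$ and $K=\mathrm{SO}_n(F)=\{g\in G: g^Tg=1\}$, and let $B\subset G$ be the Iwahori subgroup, consisting of the matrices in $\mathrm{SL}_n(A)$ that are upper triangular modulo $t$. A monomial matrix is one with exactly one non-zero entry in each row and each column. Let $i\mathsf{SymAPM}_n\subset G$ be the set of symmetric monomial matrices in $G$ such that: (i) if some diagonal entry is non-zero, then every non-zero diagonal entry has the form $t^a$ and every non-zero off-diagonal entry has the form $i\,t^a$, with $a\in\mathbb Z$; (ii) if all diagonal entries are zero, then the non-zero entries in the first row and first column have the form $\pm i\,t^a$ and all other non-zero entries have the form $i\,t^a$, with $a\in\mathbb Z$. An affine twisted involution is a pair $w=(\sigma,c)$ with $\sigma\in S_n$, $\sigma^2=1$, and $c\in\mathbb Z^n$ such that $c_{\sigma(j)}=c_j$ for all $j$ and $\sum_j c_j=0$; it is fixed-point-free if $\sigma$ has no fixed point. Let $h_w$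 (also written $h_w^+$ if $w$ is fixed-point-free) be the monomial matrix whose $(\sigma(j),j)$ entry is $t^{c_j}$ if $\sigma(j)=j$ and $i\,t^{c_j}$ otherwise. If $w$ is fixed-point-free, let $h_w^-=d\,h_w\,d$ with $d=\mathrm{diag}(-1,1,\dots,1)$. Then: 1. For each double coset $\mathcal O\in K\backslash G/B$ there is a unique $w\in i\mathsf{SymAPM}_n$ such that $g^Tg=w$ for some $g\in\mathcal O$. 2. For each $w\in i\mathsf{SymAPM}_n$ the set $\{g\in G: g^Tg=w\}$ is non-empty, and all its elements lie in the same double coset. 3. A matrix in $G$ belongs to $i\mathsf{SymAPM}_n$ if and only if it equals $h_w$ for some affine twisted involution $w$, or $h_w^-$ for some fixed-point-free affine twisted involution $w$. 4. If $w$ is a fixed-point-free affine twisted involution, then $h_w^+$ and $h_w^-$ are distinct elements of $i\mathsf{SymAPM}_n$, and if $g,g'\in G$ satisfy $g^Tg=h_w^+$ and $g'^Tg'=h_w^-$, then $KgB\neq Kg'B$. 5. The element $t-1$ has a square root in $F$. Let $s$ be any square root of $t-1$. For an affine twisted involution $w=(\sigma,c)$ define an $n\times n$ matrix $g_w$ (also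 written $g_w^+$ if $w$ is fixed-point-free), all of whose entries not listed below are zero: - for each $j$ with $\sigma(j)=j$ and $c_j$ even, the $(j,j)$ entry is $t^{c_j/2}$; - list the indices $j$ with $\sigma(j)=j$ and $c_j$ odd as $j_1<j_2<\dots<j_{2\ell}$ (there are evenly many) and pair $j_1$ with $j_2$, $j_3$ with $j_4$, and so on; for each pair $j<k$, with $a=c_j$ and $b=c_k$, the submatrix on rows and columns $\{j,k\}$ is $$\begin{pmatrix} t^{(a-1)/2} & -s\,t^{(b-1)/2}\\ s\,t^{(a-1)/2} & t^{(b-1)/2}\end{pmatrix};$$ - for each two-cycle $(j\,k)$ of $\sigma$ with $j<k$, with $a=c_j=c_k$, the submatrix on rows and columns $\{j,k\}$ is $$\begin{pmatrix} t^a/2 & i\\ i\,t^a/2 & 1\end{pmatrix}.$$ If $w$ is fixed-point-free, let $g_w^-$ be the matrix obtained from $g_w^+$ by replacing the submatrix on rows and columns $\{1,\sigma(1)\}$, with $a=c_1$, by $$\begin{pmatrix} i & -t^a/2\\ 1 & -i\,t^a/2\end{pmatrix}.$$ These matrices lie in $G$. For $h\in i\mathsf{SymAPM}_n$ put $g_h=g_w$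 if $h=h_w$, and $g_h=g_w^-$ if $h=h_w^-$ with $w$ fixed-point-free; this is well defined. Then $g_h^Tg_h=h$ for every $h\in i\mathsf{SymAPM}_n$, and $h\mapsto Kg_hB$ is a bijection from $i\mathsf{SymAPM}_n$ to $K\backslash G/B$. -/

import Mathlib

noncomputable section

open Matrix

namespace AffineSO

/-- The power `t ^ a` in the field of formal Laurent series. -/
def tpow (𝕜 : Type*) [Field 𝕜] (a : ℤ) : LaurentSeries 𝕜 := HahnSeries.single a 1

/-- The subgroup of upper triangular matrices in `SL_n(R)`. -/
def upperTriangularSL (n : ℕ) (R : Type*) [CommRing R] :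
    Subgroup (Matrix.SpecialLinearGroup (Fin n) R) where
  carrier := {g | ∀ p q : Fin n, q < p → g p q = 0}
  one_mem' := by
    intro p q h
    simp [Matrix.one_apply_ne h.ne']
  mul_mem' := by
    intro a b ha hb
    have h : BlockTriangular (a.1 * b.1) id :=
      BlockTriangular.mul (fun p q hpq => ha p q hpq) (fun p q hpq => hb p q hpq)
    exact fun p q hpq => h hpq
  inv_mem' := by
    intro a ha
    let _ : Invertible a.1 := invertibleOfIsUnitDet _ (by rw [a.2]; exact isUnit_one)
    have h : BlockTriangular a.1⁻¹ id :=
      blockTriangular_inv_of_blockTriangular (fun p q hpq => ha p q hpq)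
    have e : a.1⁻¹ = (a⁻¹).1 := by
      rw [Matrix.inv_def, a.2, Ring.inverse_one, one_smul]
      rfl
    rw [e] at h
    exact fun p q hpq => h hpq

/-- The Iwahori subgroup of `SL_n(𝕜((t)))`: the matrices of `SL_n(𝕜[[t]])` that become upper
triangular on setting `t = 0`, viewed in `SL_n(𝕜((t)))`. -/
def iwahori (n : ℕ) (𝕜 : Type*) [Field 𝕜] :
    Subgroup (Matrix.SpecialLinearGroup (Fin n) (LaurentSeries 𝕜)) :=
  ((upperTriangularSL n 𝕜).comap
    (Matrix.SpecialLinearGroup.map (PowerSeries.constantCoeff (R := 𝕜)))).map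
      (Matrix.SpecialLinearGroup.map (HahnSeries.ofPowerSeries ℤ 𝕜))

/-- The special orthogonal group `SO_n(R)`, as a subgroup of `SL_n(R)`. -/
def specialOrthogonal (n : ℕ) (R : Type*) [CommRing R] :
    Subgroup (Matrix.SpecialLinearGroup (Fin n) R) where
  carrier := {g | g.transpose * g = 1}
  one_mem' := by
    apply Subtype.ext
    change (1 : Matrix (Fin n) (Fin n) R)ᵀ * 1 = 1
    simp
  mul_mem' := by
    intro a b ha hb
    have ha' : a.1ᵀ * a.1 = 1 := congrArg Subtype.val ha
    have hb' : b.1ᵀ * b.1 = 1 := congrArg Subtype.val hb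
    apply Subtype.ext
    change (a.1 * b.1)ᵀ * (a.1 * b.1) = 1
    rw [transpose_mul, Matrix.mul_assoc, ← Matrix.mul_assoc a.1ᵀ, ha', Matrix.one_mul, hb']
  inv_mem' := by
    intro a ha
    have e : a.transpose = a⁻¹ := eq_inv_of_mul_eq_one_left ha
    have h2 : (a.transpose).transpose = a := Subtype.ext (transpose_transpose _)
    change (a⁻¹).transpose * a⁻¹ = 1
    rw [← e, h2, e, mul_inv_cancel]

/-- A matrix with exactly one non-zero entry in each row and in each column. -/
def IsMonomial {n : ℕ} {R : Type*} [Zero R] (w : Matrix (Fin n) (Fin n) R) : Prop :=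
  (∀ p, ∃! q, w p q ≠ 0) ∧ ∀ q, ∃! p, w p q ≠ 0

/-- The set `iSymAPM_n` in `SL_n(𝕜((t)))`, for a chosen square root `i` of `-1` in `𝕜`. -/
def iSymAPM (n : ℕ) [NeZero n] {𝕜 : Type*} [Field 𝕜] (i : 𝕜) :
    Set (Matrix.SpecialLinearGroup (Fin n) (LaurentSeries 𝕜)) :=
  {w | IsMonomial (w : Matrix (Fin n) (Fin n) (LaurentSeries 𝕜)) ∧
    (w : Matrix (Fin n) (Fin n) (LaurentSeries 𝕜)).IsSymm ∧
    ((∃ p, w p p ≠ 0) →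
      (∀ p, w p p ≠ 0 → ∃ a : ℤ, w p p = tpow 𝕜 a) ∧
      ∀ p q, p ≠ q → w p q ≠ 0 → ∃ a : ℤ, w p q = HahnSeries.C i * tpow 𝕜 a) ∧
    ((∀ p, w p p = 0) →
      (∀ p q, (p = 0 ∨ q = 0) → w p q ≠ 0 →
        ∃ a : ℤ, w p q = HahnSeries.C i * tpow 𝕜 a ∨ w p q = -(HahnSeries.C i * tpow 𝕜 a)) ∧
      ∀ p q, p ≠ 0 → q ≠ 0 → w p q ≠ 0 → ∃ a : ℤ, w p q = HahnSeries.C i * tpow 𝕜 a)}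

/-- The double coset space `SO_n(𝕜((t))) \ SL_n(𝕜((t))) / B`. -/
abbrev Orbits (n : ℕ) (𝕜 : Type*) [Field 𝕜] : Type _ :=
  DoubleCoset.Quotient
    (specialOrthogonal n (LaurentSeries 𝕜) :
      Set (Matrix.SpecialLinearGroup (Fin n) (LaurentSeries 𝕜)))
    (iwahori n 𝕜 : Set (Matrix.SpecialLinearGroup (Fin n) (LaurentSeries 𝕜)))

/-- The double coset `K g B`. -/
abbrev orbit {n : ℕ} {𝕜 : Type*} [Field 𝕜]
    (g : Matrix.SpecialLinearGroup (Fin n) (LaurentSeries 𝕜)) : Orbits n 𝕜 :=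
  DoubleCoset.mk (specialOrthogonal n (LaurentSeries 𝕜)) (iwahori n 𝕜) g

/-- An affine twisted involution `σ τ^c`. Its affine permutation matrix has entry `t ^ (c j)` at
`(σ j, j)`; the fields say that this matrix is symmetric and that the exponents sum to zero. -/
structure AffineTwistedInvolution (n : ℕ) where
  perm : Equiv.Perm (Fin n)
  shift : Fin n → ℤ
  perm_perm : ∀ j, perm (perm j) = j
  shift_perm : ∀ j, shift (perm j) = shift j
  sum_shift : ∑ j, shift j = 0

namespace AffineTwistedInvolution

variable {n : ℕ} {𝕜 : Type*} [Field 𝕜]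

/-- The underlying permutation has no fixed points. -/
def FixedPointFree (w : AffineTwistedInvolution n) : Prop := ∀ j, w.perm j ≠ j

/-- The matrix `h_w` (and `h_w⁺`): the affine permutation matrix of `w` with every off-diagonal
entry multiplied by `i`. -/
def hMat (i : 𝕜) (w : AffineTwistedInvolution n) : Matrix (Fin n) (Fin n) (LaurentSeries 𝕜) :=
  Matrix.of fun p q =>
    if p = w.perm q then
      if p = q then tpow 𝕜 (w.shift q) else HahnSeries.C i * tpow 𝕜 (w.shift q)
    else 0

/-- The matrix `h_w⁻ = d h_w d`, where `d = diag(-1, 1, …, 1)`. -/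
def hMinus [NeZero n] (i : 𝕜) (w : AffineTwistedInvolution n) :
    Matrix (Fin n) (Fin n) (LaurentSeries 𝕜) :=
  Matrix.diagonal (fun j => if j = 0 then -1 else 1) * w.hMat i *
    Matrix.diagonal (fun j => if j = 0 then -1 else 1)

/-- The fixed points of the underlying permutation at which the exponent is odd. -/
def oddFixed (w : AffineTwistedInvolution n) : Finset (Fin n) :=
  Finset.univ.filter fun j => w.perm j = j ∧ Odd (w.shift j)

/-- The number of odd fixed points smaller than `q`. Listing the odd fixed points increasingly, the
first is paired with the second, the third with the fourth, and so on: two distinct odd fixed points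
are paired exactly when their ranks (counted from `0`) have the same integral half. -/
def oddRank (w : AffineTwistedInvolution n) (q : Fin n) : ℕ :=
  (w.oddFixed.filter fun j => j < q).card

/-- The matrix `g_w` (and `g_w⁺`), where `s` is the chosen square root of `t - 1`:
* a fixed point with even exponent `a` contributes the diagonal entry `t ^ (a / 2)`;
* paired odd fixed points with exponents `a`, `b` contribute the block with columns
  `(t ^ ((a - 1) / 2), s t ^ ((a - 1) / 2))` and `(-s t ^ ((b - 1) / 2), t ^ ((b - 1) / 2))`;
* a two-cycle with exponent `a` contributes the block with columns
  `(t ^ a / 2, i t ^ a / 2)` and `(i, 1)`. -/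
def gMat (i : 𝕜) (s : LaurentSeries 𝕜) (w : AffineTwistedInvolution n) :
    Matrix (Fin n) (Fin n) (LaurentSeries 𝕜) :=
  Matrix.of fun p q =>
    if w.perm q = q then
      if Even (w.shift q) then
        if p = q then tpow 𝕜 (w.shift q / 2) else 0
      else if p ∈ w.oddFixed ∧ w.oddRank p / 2 = w.oddRank q / 2 then
        if p = q then tpow 𝕜 ((w.shift q - 1) / 2)
        else if p < q then -(s * tpow 𝕜 ((w.shift q - 1) / 2))
        else s * tpow 𝕜 ((w.shift q - 1) / 2)
      else 0
    else if q < w.perm q then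
      if p = q then tpow 𝕜 (w.shift q) / 2
      else if p = w.perm q then HahnSeries.C i * tpow 𝕜 (w.shift q) / 2
      else 0
    else
      if p = w.perm q then HahnSeries.C i
      else if p = q then 1
      else 0

/-- The matrix `g_w⁻` of a fixed-point-free `w`: as `g_w⁺`, except that the block of the two-cycle
containing the first index has columns `(i, 1)` and `(-t ^ a / 2, -i t ^ a / 2)`. -/
def gMinus [NeZero n] (i : 𝕜) (s : LaurentSeries 𝕜) (w : AffineTwistedInvolution n) :
    Matrix (Fin n) (Fin n) (LaurentSeries 𝕜) :=
  Matrix.of fun p q =>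
    if q = 0 then
      if p = 0 then HahnSeries.C i
      else if p = w.perm 0 then 1
      else 0
    else if q = w.perm 0 then
      if p = 0 then -(tpow 𝕜 (w.shift 0) / 2)
      else if p = w.perm 0 then -(HahnSeries.C i * tpow 𝕜 (w.shift 0) / 2)
      else 0
    else w.gMat i s p q

end AffineTwistedInvolution

end AffineSO

end

/-!
Two elements `g`, `g'` of `SL_n(𝕜((t)))` lie in the same coset of `SO_n` exactly when
`gᵀ g = g'ᵀ g'`. Hence the double cosets correspond to the classes of the symmetric matrices `gᵀ g`
under the congruence action `x ↦ bᵀ x b` of the Iwahori subgroup (`orbit_eq_iff`), and `iSymAPM` has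
to be shown to contain exactly one matrix of each class.

The Iwahori subgroup consists of the matrices of determinant one all of whose entries satisfy
`n * v(b p q) ≥ p - q`. Accordingly the entries of a symmetric matrix `x` are compared by their
weights `n * v(x p q) + p + q`. The weights of the non-zero entries of one row are distinct modulo
`n`, so an entry of minimal weight strictly dominates its row and its column.

*Existence* (`exists_mem_iSymAPM`). An entry of minimal weight serves as a pivot. On the diagonal it
clears its row and column. Off the diagonal, at `(r, p)`, the entry at `(r, r)` is first annihilated
by solving a quadratic equation whose discriminant is a square times a power series with constant
term `1` (`exists_quadratic_root`); after that the rows `r` and `p` are cleared. By induction `x`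
becomes monomial. A diagonal matrix of units then turns the entries into powers of `t` or `i` times
powers of `t`; the square roots needed exist since every element of `𝕜` is a square. The total base
change has determinant `1` or `-1`. A sign `-1` can be absorbed at a fixed point of the underlying
involution; if there is none, it turns `h_w⁺` into `h_w⁻`.

*Uniqueness* (`affineMonomial_rigidity`). If `bᵀ X b = X'` with `X` and `X'` affine monomial, the
entries of `bᵀ X = X' b⁻¹` at the pivots of `X` give an inequality between the weights of the pivots
of `X` and `X'`. By symmetry it is an equality, so `X` and `X'` have the same permutation and
exponents, and the coefficients at `(σ q, q)` differ by the factor `β q * β (σ q)`, where `β` is the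
diagonal of `b` modulo `t`. Since `∏ q, β q = 1`, the matrices `h_w⁺` and `h_w⁻` are not congruent
(`congr_hMat_ne_hMinus`): the product of these factors over the two-cycles would be `-1`.

*Representatives.* `g_w` is block diagonal with blocks of sizes one and two, the blocks being the
orbits of an involution (`IsBlockInvolution`) that pairs the fixed points with odd exponent. Its
Gram matrix and its determinant are computed block by block (`gMat_transpose_mul_self`, `det_gMat`),
and `g_w⁻` arises from `g_w⁺` by interchanging two columns up to sign (`gMinus_apply`).
-/

noncomputable section

open Matrix

namespace AffineSO

/-! ### Weights of Laurent series -/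

/-- The condition `n * v(x) ≥ m` on the order `v(x)` of a Laurent series, with `v(0) = ∞`. -/
def WeightGE {𝕜 : Type*} [Field 𝕜] (n m : ℤ) (x : LaurentSeries 𝕜) : Prop :=
  ∀ k : ℤ, n * k < m → x.coeff k = 0

section Weight

variable {𝕜 : Type*} [Field 𝕜] {n m m' : ℤ} {x y : LaurentSeries 𝕜}

lemma WeightGE.zero : WeightGE n m (0 : LaurentSeries 𝕜) := fun _ _ => rfl

lemma WeightGE.mono (hx : WeightGE n m x) (h : m' ≤ m) : WeightGE n m' x :=
  fun k hk => hx k (hk.trans_le h)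

lemma WeightGE.add (hx : WeightGE n m x) (hy : WeightGE n m y) : WeightGE n m (x + y) := by
  intro k hk
  rw [HahnSeries.coeff_add, hx k hk, hy k hk, add_zero]

lemma WeightGE.neg (hx : WeightGE n m x) : WeightGE n m (-x) := by
  intro k hk
  rw [HahnSeries.coeff_neg, hx k hk, neg_zero]

lemma WeightGE.sum {ι : Type*} {s : Finset ι} {f : ι → LaurentSeries 𝕜}
    (h : ∀ j ∈ s, WeightGE n m (f j)) : WeightGE n m (∑ j ∈ s, f j) := by
  intro k hk
  rw [HahnSeries.coeff_sum]
  exact Finset.sum_eq_zero fun j hj => h j hj k hk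

lemma WeightGE.mul (hx : WeightGE n m x) (hy : WeightGE n m' y) :
    WeightGE n (m + m') (x * y) := by
  intro k hk
  rw [HahnSeries.coeff_mul]
  refine Finset.sum_eq_zero fun ij hij => ?_
  rw [Finset.mem_antidiagonal] at hij
  have hsum : n * k = n * ij.1 + n * ij.2 := by rw [← hij.2.2, mul_add]
  rcases lt_or_ge (n * ij.1) m with h | h
  · rw [hx _ h, zero_mul]
  · rw [hy _ (by linarith), mul_zero]

lemma weightGE_iff_le_order (hn : 0 < n) (hx : x ≠ 0) : WeightGE n m x ↔ m ≤ n * x.order := by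
  constructor
  · intro h
    by_contra hlt
    exact hx (HahnSeries.coeff_order_eq_zero.1 (h _ (not_le.1 hlt)))
  · intro h k hk
    exact HahnSeries.coeff_eq_zero_of_lt_order (lt_of_mul_lt_mul_left (hk.trans_le h) hn.le)

lemma order_inv (hx : x ≠ 0) : (x⁻¹).order = -x.order := by
  have h := HahnSeries.order_mul hx (inv_ne_zero hx)
  rw [mul_inv_cancel₀ hx, HahnSeries.order_one] at h
  linarith

lemma order_div (hx : x ≠ 0) (hy : y ≠ 0) : (x / y).order = x.order - y.order := by
  rw [div_eq_mul_inv, HahnSeries.order_mul hx (inv_ne_zero hy), order_inv hy, sub_eq_add_neg]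

lemma WeightGE.div (hn : 0 < n) (hx : WeightGE n m x) (hy : y ≠ 0) (hm : n * y.order = m') :
    WeightGE n (m - m') (x / y) := by
  rw [div_eq_mul_inv, sub_eq_add_neg]
  refine hx.mul ((weightGE_iff_le_order hn (inv_ne_zero hy)).2 ?_)
  rw [order_inv hy]
  linarith

lemma weightGE_zero_of_order_eq_zero (hn : 0 < n) (hx : x.order = 0) : WeightGE n 0 x := by
  by_cases h0 : x = 0
  · exact h0 ▸ WeightGE.zero
  · rw [weightGE_iff_le_order hn h0, hx, mul_zero]

/-- A Laurent series of non-negative order is a power series. -/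
lemma WeightGE.exists_powerSeries (hn : 0 < n) (hx : WeightGE n 0 x) :
    ∃ f : PowerSeries 𝕜, HahnSeries.ofPowerSeries ℤ 𝕜 f = x := by
  refine ⟨PowerSeries.mk fun k => x.coeff k, ?_⟩
  ext k
  rcases lt_or_ge k 0 with hk | hk
  · rw [hx k (by nlinarith), PowerSeries.coeff_coe, if_pos hk]
  · rw [PowerSeries.coeff_coe, if_neg hk.not_gt, PowerSeries.coeff_mk]
    congr 1
    omega

lemma weightGE_ofPowerSeries (hn : 0 < n) (f : PowerSeries 𝕜) :
    WeightGE n 0 (HahnSeries.ofPowerSeries ℤ 𝕜 f) := by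
  intro k hk
  have hk : k < 0 := by nlinarith
  rw [PowerSeries.coeff_coe, if_pos hk]

lemma coeff_zero_ofPowerSeries (f : PowerSeries 𝕜) :
    (HahnSeries.ofPowerSeries ℤ 𝕜 f).coeff 0 = PowerSeries.constantCoeff f := by
  rw [PowerSeries.coeff_coe]
  simp

lemma order_ofPowerSeries_eq_zero {f : PowerSeries 𝕜} (hf : PowerSeries.constantCoeff f ≠ 0) :
    HahnSeries.ofPowerSeries ℤ 𝕜 f ≠ 0 ∧ (HahnSeries.ofPowerSeries ℤ 𝕜 f).order = 0 := by
  have hc := coeff_zero_ofPowerSeries f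
  have h0 : HahnSeries.ofPowerSeries ℤ 𝕜 f ≠ 0 := by
    intro h
    rw [h, HahnSeries.coeff_zero] at hc
    exact hf hc.symm
  refine ⟨h0, le_antisymm (HahnSeries.order_le_of_coeff_ne_zero (hc ▸ hf)) ?_⟩
  have := (weightGE_iff_le_order one_pos h0).1 (weightGE_ofPowerSeries one_pos f)
  linarith

/-- The coefficient of a product at the sum of two lower bounds for the orders. -/
lemma coeff_mul_add {a b : ℤ} (hx : WeightGE 1 a x) (hy : WeightGE 1 b y) :
    (x * y).coeff (a + b) = x.coeff a * y.coeff b := by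
  rw [HahnSeries.coeff_mul]
  by_cases h : x.coeff a ≠ 0 ∧ y.coeff b ≠ 0
  · refine Finset.sum_eq_single_of_mem (a, b) (by simpa [Finset.mem_antidiagonal] using h) ?_
    rintro ⟨p, q⟩ hpq hne
    rw [Finset.mem_antidiagonal] at hpq
    obtain ⟨-, -, hpq⟩ := hpq
    simp only at hpq ⊢
    rcases lt_trichotomy p a with h | h | h
    · rw [hx p (by linarith), zero_mul]
    · exact absurd (Prod.ext h (by simp only; linarith)) hne
    · rw [hy q (by linarith), mul_zero]
  · have h0 : x.coeff a * y.coeff b = 0 := by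
      rw [mul_eq_zero]; tauto
    rw [h0]
    refine Finset.sum_eq_zero ?_
    rintro ⟨p, q⟩ hpq
    rw [Finset.mem_antidiagonal] at hpq
    obtain ⟨-, -, hpq⟩ := hpq
    simp only at hpq ⊢
    rcases lt_trichotomy p a with h | rfl | h
    · rw [hx p (by linarith), zero_mul]
    · rwa [show q = b by linarith]
    · rw [hy q (by linarith), mul_zero]

end Weight

/-! ### Square roots of power series -/

section SquareRoot

variable {𝕜 : Type*} [Field 𝕜]

/-- The coefficients of the square root of `∑ f k t ^ k` with constant coefficient `r`. -/
def sqrtCoeff (f : ℕ → 𝕜) (r : 𝕜) : ℕ → 𝕜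
  | 0 => r
  | n + 1 => (f (n + 1) - ∑ k : Fin n, sqrtCoeff f r (k + 1) * sqrtCoeff f r (n - k)) / (2 * r)

lemma exists_powerSeries_sq_eq (h2 : (2 : 𝕜) ≠ 0) (f : PowerSeries 𝕜) {r : 𝕜} (hr : r ≠ 0)
    (hf : r ^ 2 = PowerSeries.constantCoeff f) :
    ∃ g : PowerSeries 𝕜, g ^ 2 = f ∧ PowerSeries.constantCoeff g = r := by
  set a := sqrtCoeff (fun k => PowerSeries.coeff k f) r with ha
  have h0 : a 0 = r := by rw [ha, sqrtCoeff]
  refine ⟨PowerSeries.mk a, ?_, by simp [h0]⟩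
  ext m
  rw [pow_two, PowerSeries.coeff_mul]
  simp only [PowerSeries.coeff_mk]
  rw [Finset.Nat.sum_antidiagonal_eq_sum_range_succ_mk]
  cases m with
  | zero => simp [h0, ← hf, pow_two]
  | succ m =>
    have hrec : a (m + 1) = (PowerSeries.coeff (m + 1) f
        - ∑ k ∈ Finset.range m, a (k + 1) * a (m - k)) / (2 * r) := by
      conv_lhs => rw [ha, sqrtCoeff]
      rw [Finset.sum_range]
    rw [Finset.sum_range_succ, Finset.sum_range_succ']
    simp only [Nat.sub_zero, Nat.sub_self, h0, Nat.add_sub_add_right]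
    rw [eq_div_iff (mul_ne_zero h2 hr)] at hrec
    linear_combination hrec

lemma exists_sq_eq_of_order_eq_zero (h2 : (2 : 𝕜) ≠ 0) {u : LaurentSeries 𝕜} (hu : u.order = 0)
    {r : 𝕜} (hr : r ≠ 0) (hru : r ^ 2 = u.coeff 0) :
    ∃ v : LaurentSeries 𝕜, v ^ 2 = u ∧ v ≠ 0 ∧ v.order = 0 ∧ v.coeff 0 = r := by
  obtain ⟨f, rfl⟩ :=
    (weightGE_zero_of_order_eq_zero (n := 1) one_pos hu).exists_powerSeries one_pos
  rw [coeff_zero_ofPowerSeries] at hru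
  obtain ⟨g, hg, hgr⟩ := exists_powerSeries_sq_eq h2 f hr hru
  obtain ⟨hg0, hgo⟩ := order_ofPowerSeries_eq_zero (f := g) (hgr ▸ hr)
  exact ⟨HahnSeries.ofPowerSeries ℤ 𝕜 g, by rw [← map_pow, hg], hg0, hgo,
    by rw [coeff_zero_ofPowerSeries, hgr]⟩

lemma exists_sq_eq_of_isSquare (h2 : (2 : 𝕜) ≠ 0) (hsq : ∀ x : 𝕜, IsSquare x)
    {u : LaurentSeries 𝕜} (hu0 : u ≠ 0) (hu : u.order = 0) :
    ∃ v : LaurentSeries 𝕜, v ^ 2 = u ∧ v ≠ 0 ∧ v.order = 0 := by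
  have hc : u.coeff 0 ≠ 0 := by
    rw [← hu]
    exact fun h => hu0 (HahnSeries.coeff_order_eq_zero.1 h)
  obtain ⟨r, hr⟩ := hsq (u.coeff 0)
  have hr0 : r ≠ 0 := by
    rintro rfl
    exact hc (by rw [hr, mul_zero])
  obtain ⟨v, h1, h3, h4, -⟩ := exists_sq_eq_of_order_eq_zero h2 hu hr0 (by rw [hr, pow_two])
  exact ⟨v, h1, h3, h4⟩

lemma exists_sq_eq_tpow_sub_one (h2 : (2 : 𝕜) ≠ 0) {i : 𝕜} (hi : i ^ 2 = -1) :
    ∃ s : LaurentSeries 𝕜, s ^ 2 = tpow 𝕜 1 - 1 := by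
  have hi0 : i ≠ 0 := by rintro rfl; norm_num at hi
  obtain ⟨g, hg, -⟩ := exists_powerSeries_sq_eq h2 (PowerSeries.X - 1 : PowerSeries 𝕜) hi0
    (by simp [hi])
  refine ⟨HahnSeries.ofPowerSeries ℤ 𝕜 g, ?_⟩
  rw [← map_pow, hg, map_sub, map_one, HahnSeries.ofPowerSeries_X, tpow]

end SquareRoot

/-! ### The Iwahori subgroup and its order -/

section Iwahori

variable {n : ℕ} {𝕜 : Type*} [Field 𝕜]

/-- The hereditary order whose elements of determinant one form the Iwahori subgroup: the entry at
`(p, q)` is subject to `n * v ≥ p - q`, so that it is integral, and divisible by `t` below the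
diagonal. -/
def InIwahoriOrder (b : Matrix (Fin n) (Fin n) (LaurentSeries 𝕜)) : Prop :=
  ∀ p q : Fin n, WeightGE (n : ℤ) ((p : ℤ) - (q : ℤ)) (b p q)

lemma InIwahoriOrder.mul {a b : Matrix (Fin n) (Fin n) (LaurentSeries 𝕜)}
    (ha : InIwahoriOrder a) (hb : InIwahoriOrder b) : InIwahoriOrder (a * b) := by
  intro p q
  rw [Matrix.mul_apply]
  exact WeightGE.sum fun r _ => ((ha p r).mul (hb r q)).mono (by linarith)

lemma inIwahoriOrder_diagonal {d : Fin n → LaurentSeries 𝕜} (hd : ∀ j, (d j).order = 0) :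
    InIwahoriOrder (Matrix.diagonal d) := by
  intro p q
  by_cases h : p = q
  · subst h
    have hn : (0 : ℤ) < n := by have := p.isLt; omega
    rw [Matrix.diagonal_apply_eq, sub_self]
    exact weightGE_zero_of_order_eq_zero hn (hd p)
  · rw [Matrix.diagonal_apply_ne _ h]
    exact WeightGE.zero

lemma InIwahoriOrder.weightGE_zero {b : Matrix (Fin n) (Fin n) (LaurentSeries 𝕜)}
    (hb : InIwahoriOrder b) (p q : Fin n) : WeightGE (n : ℤ) 0 (b p q) := by
  intro k hk
  have hn : (0 : ℤ) < n := by have := p.isLt; omega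
  refine hb p q k ?_
  have hk : k ≤ -1 := by
    by_contra h
    have : 0 ≤ k := by omega
    nlinarith
  have := q.isLt
  nlinarith

/-- An element of the Iwahori subgroup satisfies the weight inequalities, and its constant terms on
the diagonal multiply to one. -/
lemma of_mem_iwahori {b : Matrix.SpecialLinearGroup (Fin n) (LaurentSeries 𝕜)}
    (hb : b ∈ iwahori n 𝕜) :
    InIwahoriOrder (b : Matrix (Fin n) (Fin n) (LaurentSeries 𝕜)) ∧
      ∏ p, (b p p).coeff 0 = 1 := by
  obtain ⟨c, hc, rfl⟩ := hb
  have hentry : ∀ p q, (Matrix.SpecialLinearGroup.map (HahnSeries.ofPowerSeries ℤ 𝕜) c) p q =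
      HahnSeries.ofPowerSeries ℤ 𝕜 (c p q) := fun p q => rfl
  have htri : ∀ p q : Fin n, q < p → PowerSeries.constantCoeff (c p q) = 0 := hc
  constructor
  · intro p q
    have hn : (0 : ℤ) < n := by have := p.isLt; omega
    rw [hentry]
    intro k hk
    rw [PowerSeries.coeff_coe]
    split_ifs with h0
    · rfl
    · have hp := p.isLt
      have hk0 : k = 0 := by
        by_contra hne
        have h1 : 1 ≤ k := by omega
        nlinarith
      subst hk0
      have hlt : q < p := by rw [Fin.lt_def]; omega
      simpa using htri p q hlt
  · have hdet := (Matrix.SpecialLinearGroup.map (PowerSeries.constantCoeff (R := 𝕜)) c).2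
    have htri' : (Matrix.SpecialLinearGroup.map
        (PowerSeries.constantCoeff (R := 𝕜)) c).1.IsUpperTriangular :=
      fun p q hpq => htri p q hpq
    rw [Matrix.det_of_isUpperTriangular htri'] at hdet
    rw [← hdet]
    refine Finset.prod_congr rfl fun p _ => ?_
    rw [hentry, coeff_zero_ofPowerSeries]
    rfl

lemma mem_iwahori_of_inIwahoriOrder {b : Matrix.SpecialLinearGroup (Fin n) (LaurentSeries 𝕜)}
    (hb : InIwahoriOrder (b : Matrix (Fin n) (Fin n) (LaurentSeries 𝕜))) :
    b ∈ iwahori n 𝕜 := by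
  have hlift : ∀ p q, ∃ f : PowerSeries 𝕜, HahnSeries.ofPowerSeries ℤ 𝕜 f = b p q := by
    intro p q
    have hn : (0 : ℤ) < n := by have := p.isLt; omega
    exact (hb.weightGE_zero p q).exists_powerSeries hn
  choose c hc using hlift
  have hmap : (HahnSeries.ofPowerSeries ℤ 𝕜).mapMatrix (Matrix.of c) = b.1 := by
    ext1 p q
    exact hc p q
  have hdet : (Matrix.of c).det = 1 := by
    apply HahnSeries.ofPowerSeries_injective (Γ := ℤ) (R := 𝕜)
    rw [RingHom.map_det, hmap, b.2, map_one]
  refine ⟨⟨Matrix.of c, hdet⟩, ?_, Subtype.ext hmap⟩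
  change ∀ p q : Fin n, q < p → PowerSeries.constantCoeff (c p q) = 0
  intro p q hpq
  rw [← coeff_zero_ofPowerSeries, hc]
  refine hb p q 0 ?_
  rw [Fin.lt_def] at hpq
  omega

/-- Sending `g` to `gᵀ g` identifies the double cosets with the classes of their values under the
congruence action of the Iwahori subgroup. -/
lemma orbit_eq_iff (g g' : Matrix.SpecialLinearGroup (Fin n) (LaurentSeries 𝕜)) :
    orbit g = orbit g' ↔ ∃ b ∈ iwahori n 𝕜,
      (b.1)ᵀ * (g.1ᵀ * g.1) * b.1 = g'.1ᵀ * g'.1 := by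
  rw [orbit, orbit, DoubleCoset.eq]
  constructor
  · rintro ⟨k, hk, b, hb, rfl⟩
    refine ⟨b, hb, ?_⟩
    have hk' : k.1ᵀ * k.1 = 1 := congrArg Subtype.val hk
    change _ = (k.1 * g.1 * b.1)ᵀ * (k.1 * g.1 * b.1)
    calc (b.1)ᵀ * (g.1ᵀ * g.1) * b.1 = (b.1)ᵀ * (g.1ᵀ * (1 * g.1)) * b.1 := by rw [Matrix.one_mul]
      _ = _ := by
        rw [← hk', Matrix.transpose_mul, Matrix.transpose_mul]
        simp only [Matrix.mul_assoc]
  · rintro ⟨b, hb, h⟩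
    have hSL : b.transpose * (g.transpose * g) * b = g'.transpose * g' := Subtype.ext h
    have htr : ∀ x y : Matrix.SpecialLinearGroup (Fin n) (LaurentSeries 𝕜),
        (x * y).transpose = y.transpose * x.transpose :=
      fun x y => Subtype.ext (Matrix.transpose_mul _ _)
    have htr1 : (1 : Matrix.SpecialLinearGroup (Fin n) (LaurentSeries 𝕜)).transpose = 1 :=
      Subtype.ext Matrix.transpose_one
    refine ⟨g' * (g * b)⁻¹, ?_, b, hb, by group⟩
    change (g' * (g * b)⁻¹).transpose * (g' * (g * b)⁻¹) = 1
    have hinv : ((g * b)⁻¹).transpose * (g * b).transpose = 1 := by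
      rw [← htr, mul_inv_cancel, htr1]
    calc (g' * (g * b)⁻¹).transpose * (g' * (g * b)⁻¹)
        = ((g * b)⁻¹).transpose * (g'.transpose * g') * (g * b)⁻¹ := by
          rw [htr]; simp only [mul_assoc]
      _ = (((g * b)⁻¹).transpose * (g * b).transpose) * ((g * b) * (g * b)⁻¹) := by
          rw [← hSL, htr g b]; simp only [mul_assoc]
      _ = 1 := by rw [hinv, mul_inv_cancel, one_mul]

lemma orbit_eq_of_transpose_mul_eq {g g' : Matrix.SpecialLinearGroup (Fin n) (LaurentSeries 𝕜)}
    (h : g.transpose * g = g'.transpose * g') : orbit g = orbit g' := by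
  refine (orbit_eq_iff g g').2 ⟨1, one_mem _, ?_⟩
  have h' : g.1ᵀ * g.1 = g'.1ᵀ * g'.1 := congrArg Subtype.val h
  change (1 : Matrix (Fin n) (Fin n) (LaurentSeries 𝕜))ᵀ * _ * 1 = _
  rw [h', Matrix.transpose_one, Matrix.one_mul, Matrix.mul_one]

end Iwahori

/-! ### Rigidity of affine monomial matrices -/

section Rigidity

variable {n : ℕ} {𝕜 : Type*} [Field 𝕜]

/-- The matrix with entry `κ q * t ^ c q` at `(σ q, q)` and zeros elsewhere. -/
def affineMonomial (σ : Equiv.Perm (Fin n)) (c : Fin n → ℤ) (κ : Fin n → 𝕜) :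
    Matrix (Fin n) (Fin n) (LaurentSeries 𝕜) :=
  Matrix.of fun p q => if p = σ q then HahnSeries.single (c q) (κ q) else 0

lemma affineMonomial_apply (σ : Equiv.Perm (Fin n)) (c : Fin n → ℤ) (κ : Fin n → 𝕜)
    (p q : Fin n) :
    affineMonomial σ c κ p q = if p = σ q then HahnSeries.single (c q) (κ q) else 0 := rfl

lemma affineMonomial_apply_self (σ : Equiv.Perm (Fin n)) (c : Fin n → ℤ) (κ : Fin n → 𝕜)
    (q : Fin n) : affineMonomial σ c κ (σ q) q = HahnSeries.single (c q) (κ q) := by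
  rw [affineMonomial_apply, if_pos rfl]

/-- The entry of `bᵀ X = X' c` in the column `q` and the row of the pivot of `X`. -/
lemma entry_of_transpose_mul_affineMonomial {σ σ' : Equiv.Perm (Fin n)} {c c' : Fin n → ℤ}
    {κ κ' : Fin n → 𝕜} {b d : Matrix (Fin n) (Fin n) (LaurentSeries 𝕜)}
    (h : bᵀ * affineMonomial σ c κ = affineMonomial σ' c' κ' * d) (q : Fin n) :
    b (σ q) (σ q) * HahnSeries.single (c q) (κ q) =
      HahnSeries.single (c' (σ'.symm (σ q))) (κ' (σ'.symm (σ q))) * d (σ'.symm (σ q)) q := by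
  have he := congrFun (congrFun h (σ q)) q
  rw [Matrix.mul_apply, Matrix.mul_apply, Finset.sum_eq_single (σ q),
    Finset.sum_eq_single (σ'.symm (σ q))] at he
  · simpa [affineMonomial_apply] using he
  · intro r _ hr
    rw [affineMonomial_apply, if_neg, zero_mul]
    rintro h
    exact hr (by rw [h, Equiv.symm_apply_apply])
  · simp
  · intro r _ hr
    rw [affineMonomial_apply, if_neg hr, mul_zero]
  · simp

lemma weight_le_of_transpose_mul_affineMonomial {σ σ' : Equiv.Perm (Fin n)} {c c' : Fin n → ℤ}
    {κ κ' : Fin n → 𝕜} {b d : Matrix (Fin n) (Fin n) (LaurentSeries 𝕜)}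
    (h : bᵀ * affineMonomial σ c κ = affineMonomial σ' c' κ' * d)
    (hd : InIwahoriOrder d) (hκ : ∀ q, κ q ≠ 0) (hb : ∀ p, (b p p).coeff 0 ≠ 0) (p : Fin n) :
    n * c' (σ'.symm p) + (σ'.symm p : ℤ) ≤ n * c (σ.symm p) + (σ.symm p : ℤ) := by
  obtain ⟨q, rfl⟩ := σ.surjective p
  rw [Equiv.symm_apply_apply]
  have he := entry_of_transpose_mul_affineMonomial h q
  set r := σ'.symm (σ q)
  by_contra hlt
  rw [not_le] at hlt
  have hc := congrFun (congrArg HahnSeries.coeff he) (c q)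
  have hL := HahnSeries.coeff_mul_single_add (r := κ q) (x := b (σ q) (σ q)) (a := 0) (b := c q)
  rw [zero_add] at hL
  have hR := HahnSeries.coeff_single_mul_add (r := κ' r) (x := d r q) (a := c q - c' r) (b := c' r)
  rw [sub_add_cancel] at hR
  rw [hL, hR, hd r q _ (by linarith), mul_zero] at hc
  exact mul_ne_zero (hb _) (hκ q) hc

/-- Affine monomial matrices that are congruent under the Iwahori subgroup have the same underlying
affine permutation, and their coefficients differ by the constant terms on the diagonal. -/
lemma affineMonomial_rigidity {σ σ' : Equiv.Perm (Fin n)} {c c' : Fin n → ℤ}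
    {κ κ' : Fin n → 𝕜} (hκ : ∀ q, κ q ≠ 0) (hκ' : ∀ q, κ' q ≠ 0)
    {b : Matrix.SpecialLinearGroup (Fin n) (LaurentSeries 𝕜)} (hb : b ∈ iwahori n 𝕜)
    (h : b.1ᵀ * affineMonomial σ c κ * b.1 = affineMonomial σ' c' κ') :
    σ = σ' ∧ c = c' ∧ ∀ q, (b (σ q) (σ q)).coeff 0 * (b q q).coeff 0 * κ q = κ' q := by
  set d := b⁻¹ with hd
  have hdI : d ∈ iwahori n 𝕜 := inv_mem hb
  have hbd : b.1 * d.1 = 1 := congrArg Subtype.val (mul_inv_cancel b)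
  have hdb : d.1ᵀ * b.1ᵀ = 1 := by rw [← Matrix.transpose_mul, hbd, Matrix.transpose_one]
  have h1 : b.1ᵀ * affineMonomial σ c κ = affineMonomial σ' c' κ' * d.1 := by
    rw [← h, Matrix.mul_assoc _ b.1, hbd, Matrix.mul_one]
  have h2 : d.1ᵀ * affineMonomial σ' c' κ' = affineMonomial σ c κ * b.1 := by
    rw [← h, Matrix.mul_assoc b.1ᵀ, ← Matrix.mul_assoc, hdb, Matrix.one_mul]
  obtain ⟨hbO, hbP⟩ := of_mem_iwahori hb
  obtain ⟨hdO, hdP⟩ := of_mem_iwahori hdI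
  have hb0 : ∀ p, (b p p).coeff 0 ≠ 0 := fun p =>
    Finset.prod_ne_zero_iff.1 (hbP ▸ one_ne_zero) p (Finset.mem_univ p)
  have hd0 : ∀ p, (d p p).coeff 0 ≠ 0 := fun p =>
    Finset.prod_ne_zero_iff.1 (hdP ▸ one_ne_zero) p (Finset.mem_univ p)
  have heq : ∀ p, (n : ℤ) * c' (σ'.symm p) + (σ'.symm p : ℤ) = n * c (σ.symm p) + (σ.symm p : ℤ) :=
    fun p => le_antisymm (weight_le_of_transpose_mul_affineMonomial h1 hdO hκ hb0 p)
      (weight_le_of_transpose_mul_affineMonomial h2 hbO hκ' hd0 p)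
  -- both summands can be read off from the weight, by division with remainder
  have hboth : ∀ p, c' (σ'.symm p) = c (σ.symm p) ∧ σ'.symm p = σ.symm p := by
    intro p
    have hp := heq p
    have l1 := (σ.symm p).isLt
    have l2 := (σ'.symm p).isLt
    have hc : c' (σ'.symm p) = c (σ.symm p) := by
      rcases lt_trichotomy (c' (σ'.symm p)) (c (σ.symm p)) with hlt | he | hlt
      · nlinarith
      · exact he
      · nlinarith
    refine ⟨hc, Fin.ext ?_⟩
    rw [hc] at hp
    omega
  have hσ : σ = σ' := by
    rw [← Equiv.symm_symm σ, ← Equiv.symm_symm σ',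
      show σ.symm = σ'.symm from Equiv.ext fun p => (hboth p).2.symm]
  subst hσ
  have hcc : c = c' := by
    funext q
    simpa using (hboth (σ q)).1.symm
  subst hcc
  refine ⟨rfl, rfl, fun q => ?_⟩
  have he := entry_of_transpose_mul_affineMonomial h1 q
  rw [Equiv.symm_apply_apply] at he
  have hc := congrFun (congrArg HahnSeries.coeff he) (c q)
  have hL := HahnSeries.coeff_mul_single_add (r := κ q) (x := b (σ q) (σ q)) (a := 0) (b := c q)
  have hR := HahnSeries.coeff_single_mul_add (r := κ' q) (x := d q q) (a := 0) (b := c q)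
  rw [zero_add] at hL hR
  rw [hL, hR] at hc
  -- modulo `t` both `b` and its inverse are upper triangular, so their diagonals are inverse
  have hone : (b q q).coeff 0 * (d q q).coeff 0 = 1 := by
    have h1 := congrArg (fun x => HahnSeries.coeff x 0) (congrFun (congrFun hbd q) q)
    simp only [Matrix.mul_apply, HahnSeries.coeff_sum, Matrix.one_apply_eq] at h1
    have hn : (0 : ℤ) < n := by have := q.isLt; omega
    have hI : ∀ x : LaurentSeries 𝕜, WeightGE (n : ℤ) 0 x → WeightGE 1 0 x :=
      fun x hx k hk => hx k (by nlinarith)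
    have hterm : ∀ r, (b.1 q r * d.1 r q).coeff 0 = (b.1 q r).coeff 0 * (d.1 r q).coeff 0 := by
      intro r
      have := coeff_mul_add (hI _ (hbO.weightGE_zero q r)) (hI _ (hdO.weightGE_zero r q))
      simpa using this
    rw [Finset.sum_eq_single q, hterm, HahnSeries.coeff_one, if_pos rfl] at h1
    · exact h1
    · intro r _ hr
      rw [hterm]
      rcases lt_or_gt_of_ne hr with hlt | hlt
      · rw [hbO q r 0 (by rw [Fin.lt_def] at hlt; omega), zero_mul]
      · rw [hdO r q 0 (by rw [Fin.lt_def] at hlt; omega), mul_zero]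
    · simp
  calc (b (σ q) (σ q)).coeff 0 * (b q q).coeff 0 * κ q
      = ((b (σ q) (σ q)).coeff 0 * κ q) * (b q q).coeff 0 := by ring
    _ = κ' q * ((b q q).coeff 0 * (d q q).coeff 0) := by rw [hc]; ring
    _ = κ' q := by rw [hone, mul_one]

end Rigidity

/-! ### Classification of the symmetric affine permutation matrices -/

section Classification

variable {n : ℕ} {𝕜 : Type*} [Field 𝕜]

lemma C_mul_tpow (k : 𝕜) (a : ℤ) : HahnSeries.C k * tpow 𝕜 a = HahnSeries.single a k := by
  rw [tpow, HahnSeries.C_apply, HahnSeries.single_mul_single, zero_add, mul_one]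

lemma C_mul_self {i : 𝕜} (hi : i ^ 2 = -1) :
    HahnSeries.C i * HahnSeries.C i = (-1 : LaurentSeries 𝕜) := by
  rw [← map_mul, ← pow_two, hi, map_neg, map_one]

lemma two_ne_zero_laurentSeries (h2 : (2 : 𝕜) ≠ 0) : (2 : LaurentSeries 𝕜) ≠ 0 := by
  have h : (2 : LaurentSeries 𝕜) = HahnSeries.C (2 : 𝕜) := by rw [map_ofNat]
  rw [h]
  exact HahnSeries.C_ne_zero h2

lemma tpow_ne_zero (a : ℤ) : tpow 𝕜 a ≠ 0 := HahnSeries.single_ne_zero one_ne_zero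

lemma tpow_mul_tpow (a b : ℤ) : tpow 𝕜 a * tpow 𝕜 b = tpow 𝕜 (a + b) := by
  rw [tpow, tpow, HahnSeries.single_mul_single, mul_one, tpow]

lemma tpow_zero : tpow 𝕜 0 = 1 := rfl

lemma tpow_sum {ι : Type*} (s : Finset ι) (a : ι → ℤ) :
    ∏ j ∈ s, tpow 𝕜 (a j) = tpow 𝕜 (∑ j ∈ s, a j) := by
  classical
  induction s using Finset.induction_on with
  | empty => simp [tpow_zero]
  | insert j s hj ih => rw [Finset.prod_insert hj, Finset.sum_insert hj, ih, tpow_mul_tpow]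

lemma det_affineMonomial (σ : Equiv.Perm (Fin n)) (c : Fin n → ℤ) {κ : Fin n → 𝕜}
    (hκ : ∀ q, κ q ≠ 0) :
    (affineMonomial σ c κ).det ≠ 0 ∧ (affineMonomial σ c κ).det.order = ∑ q, c q := by
  have hsub : affineMonomial σ c κ =
      (Matrix.diagonal fun q => HahnSeries.single (c q) (κ q)).submatrix σ.symm id := by
    ext1 p q
    rw [affineMonomial_apply, Matrix.submatrix_apply, Matrix.diagonal_apply, id]
    by_cases h : p = σ q
    · subst h; simp
    · rw [if_neg h, if_neg fun h' => h (by rw [← h', Equiv.apply_symm_apply])]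
  have hprod : (∏ q, HahnSeries.single (c q) (κ q) : LaurentSeries 𝕜) =
      HahnSeries.single (∑ q, c q) (∏ q, κ q) := by
    simp_rw [← C_mul_tpow]
    rw [Finset.prod_mul_distrib, tpow_sum, map_prod]
  have hne : ∏ q, κ q ≠ 0 := Finset.prod_ne_zero_iff.2 fun q _ => hκ q
  rw [hsub, Matrix.det_permute, Matrix.det_diagonal, hprod]
  rcases Int.units_eq_one_or (Equiv.Perm.sign σ.symm) with h | h <;> rw [h]
  · simp [hne]
  · simp [hne]

lemma isMonomial_affineMonomial (σ : Equiv.Perm (Fin n)) (c : Fin n → ℤ) {κ : Fin n → 𝕜}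
    (hκ : ∀ q, κ q ≠ 0) : IsMonomial (affineMonomial σ c κ) := by
  have h : ∀ p q, affineMonomial σ c κ p q ≠ 0 ↔ p = σ q := by
    intro p q
    rw [affineMonomial_apply]
    split_ifs with h <;> simp [h, hκ]
  refine ⟨fun p => ⟨σ.symm p, (h _ _).2 (by simp), fun q hq => ?_⟩,
    fun q => ⟨σ q, (h _ _).2 rfl, fun p hp => (h _ _).1 hp⟩⟩
  rw [(h _ _).1 hq, Equiv.symm_apply_apply]

/-- The support of a symmetric monomial matrix is the graph of an involution. -/
lemma exists_perm_of_isMonomial {R : Type*} [Zero R] {M : Matrix (Fin n) (Fin n) R}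
    (hM : IsMonomial M) (hS : M.IsSymm) :
    ∃ σ : Equiv.Perm (Fin n), (∀ q, σ (σ q) = q) ∧ ∀ p q, M p q ≠ 0 ↔ p = σ q := by
  choose f hf hfu using hM.2
  have hff : ∀ q, f (f q) = q := by
    intro q
    refine (hfu (f q) q ?_).symm
    change M q (f q) ≠ 0
    rw [hS.apply]
    exact hf q
  refine ⟨⟨f, f, hff, hff⟩, hff, fun p q => ⟨fun h => hfu q p h, ?_⟩⟩
  rintro rfl
  exact hf q

namespace AffineTwistedInvolution

lemma ext' {w w' : AffineTwistedInvolution n} (h1 : w.perm = w'.perm)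
    (h2 : w.shift = w'.shift) : w = w' := by
  cases w; cases w'; cases h1; cases h2; rfl

/-- The coefficients of the entries of `h_w`. -/
def hCoeff (i : 𝕜) (w : AffineTwistedInvolution n) (q : Fin n) : 𝕜 :=
  if w.perm q = q then 1 else i

/-- The diagonal of `diag(-1, 1, …, 1)`. -/
def signAt [NeZero n] (𝕜 : Type*) [Field 𝕜] (q : Fin n) : 𝕜 := if q = 0 then -1 else 1

lemma signAt_mul_self [NeZero n] (q : Fin n) : signAt 𝕜 q * signAt 𝕜 q = 1 := by
  rw [signAt]; split_ifs <;> simp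

lemma signAt_ne_zero [NeZero n] (q : Fin n) : signAt 𝕜 q ≠ 0 := by
  intro h
  simpa [h] using signAt_mul_self (𝕜 := 𝕜) q

lemma hCoeff_ne_zero {i : 𝕜} (hi : i ≠ 0) (w : AffineTwistedInvolution n) (q : Fin n) :
    w.hCoeff i q ≠ 0 := by
  rw [hCoeff]; split_ifs <;> simp [hi]

lemma hCoeff_perm (i : 𝕜) (w : AffineTwistedInvolution n) (q : Fin n) :
    w.hCoeff i (w.perm q) = w.hCoeff i q := by
  rw [hCoeff, hCoeff, w.perm_perm]
  simp only [eq_comm]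

lemma hMat_eq (i : 𝕜) (w : AffineTwistedInvolution n) :
    w.hMat i = affineMonomial w.perm w.shift (w.hCoeff i) := by
  ext1 p q
  rw [affineMonomial_apply, hMat, Matrix.of_apply, hCoeff]
  by_cases h : p = w.perm q
  · subst h
    rw [if_pos rfl, if_pos rfl]
    split_ifs
    · rfl
    · rw [C_mul_tpow]
  · rw [if_neg h, if_neg h]

lemma hMinus_apply [NeZero n] (i : 𝕜) (w : AffineTwistedInvolution n) (p q : Fin n) :
    w.hMinus i p q = HahnSeries.C (signAt 𝕜 p) * w.hMat i p q * HahnSeries.C (signAt 𝕜 q) := by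
  rw [hMinus, Matrix.mul_diagonal, Matrix.diagonal_mul]
  simp only [signAt]
  split_ifs <;> simp

lemma hMinus_eq [NeZero n] (i : 𝕜) (w : AffineTwistedInvolution n) :
    w.hMinus i = affineMonomial w.perm w.shift
      (fun q => signAt 𝕜 (w.perm q) * signAt 𝕜 q * w.hCoeff i q) := by
  ext1 p q
  rw [hMinus_apply, hMat_eq, affineMonomial_apply, affineMonomial_apply]
  by_cases h : p = w.perm q
  · subst h
    rw [if_pos rfl, if_pos rfl, ← C_mul_tpow, ← C_mul_tpow, map_mul, map_mul]
    ring
  · rw [if_neg h, if_neg h, mul_zero, zero_mul]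

lemma eq_of_congr_hMat {i : 𝕜} (hi : i ≠ 0) {w w' : AffineTwistedInvolution n}
    {b : Matrix.SpecialLinearGroup (Fin n) (LaurentSeries 𝕜)} (hb : b ∈ iwahori n 𝕜)
    (h : b.1ᵀ * w.hMat i * b.1 = w'.hMat i) : w = w' := by
  rw [hMat_eq, hMat_eq] at h
  obtain ⟨h1, h2, -⟩ := affineMonomial_rigidity (hCoeff_ne_zero hi w) (hCoeff_ne_zero hi w') hb h
  exact ext' h1 h2

lemma eq_of_congr_hMinus [NeZero n] {i : 𝕜} (hi : i ≠ 0) {w w' : AffineTwistedInvolution n}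
    {b : Matrix.SpecialLinearGroup (Fin n) (LaurentSeries 𝕜)} (hb : b ∈ iwahori n 𝕜)
    (h : b.1ᵀ * w.hMinus i * b.1 = w'.hMinus i) : w = w' := by
  rw [hMinus_eq, hMinus_eq] at h
  have hne : ∀ w : AffineTwistedInvolution n, ∀ q,
      signAt 𝕜 (w.perm q) * signAt 𝕜 q * w.hCoeff i q ≠ 0 := fun w q =>
    mul_ne_zero (mul_ne_zero (signAt_ne_zero _) (signAt_ne_zero _)) (hCoeff_ne_zero hi w q)
  obtain ⟨h1, h2, -⟩ := affineMonomial_rigidity (hne w) (hne w') hb h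
  exact ext' h1 h2

/-- The constant terms on the diagonal of an Iwahori element carrying `h_w⁺` to `h_w⁻` would
multiply to `-1`: over each two-cycle they multiply to `1`, except for the cycle of the first
index, where they multiply to `-1`. -/
lemma congr_hMat_ne_hMinus [NeZero n] (h2 : (2 : 𝕜) ≠ 0) {i : 𝕜} (hi : i ≠ 0)
    {w w' : AffineTwistedInvolution n} (hw : w'.FixedPointFree)
    {b : Matrix.SpecialLinearGroup (Fin n) (LaurentSeries 𝕜)} (hb : b ∈ iwahori n 𝕜) :
    b.1ᵀ * w.hMat i * b.1 ≠ w'.hMinus i := by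
  intro h
  rw [hMat_eq, hMinus_eq] at h
  obtain ⟨h1, h3, hβ⟩ := affineMonomial_rigidity (hCoeff_ne_zero hi w)
    (fun q => mul_ne_zero (mul_ne_zero (signAt_ne_zero _) (signAt_ne_zero _))
      (hCoeff_ne_zero hi w' q)) hb h
  obtain rfl := ext' h1 h3
  have hprod := (of_mem_iwahori hb).2
  have hpair : ∀ q, (b q q).coeff 0 * signAt 𝕜 q *
      ((b (w.perm q) (w.perm q)).coeff 0 * signAt 𝕜 (w.perm q)) = 1 := by
    intro q
    have hq := mul_right_cancel₀ (hCoeff_ne_zero hi w q) (hβ q)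
    calc _ = ((b (w.perm q) (w.perm q)).coeff 0 * (b q q).coeff 0) *
          (signAt 𝕜 q * signAt 𝕜 (w.perm q)) := by ring
      _ = (signAt 𝕜 (w.perm q) * signAt 𝕜 (w.perm q)) * (signAt 𝕜 q * signAt 𝕜 q) := by
        rw [hq]; ring
      _ = 1 := by rw [signAt_mul_self, signAt_mul_self, one_mul]
  have hinv : ∏ q, ((b q q).coeff 0 * signAt 𝕜 q) = 1 :=
    Finset.prod_involution (fun q _ => w.perm q) (fun q _ => hpair q) (fun q _ _ => hw q)
      (fun _ _ => Finset.mem_univ _) (fun q _ => w.perm_perm q)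
  have hsign : ∏ q : Fin n, signAt 𝕜 q = -1 := by
    simp [signAt, Finset.prod_ite_eq']
  rw [Finset.prod_mul_distrib, hprod, hsign, one_mul] at hinv
  exact h2 (by linear_combination -hinv)

lemma hMat_ne_hMinus [NeZero n] (h2 : (2 : 𝕜) ≠ 0) {i : 𝕜} (hi : i ≠ 0)
    {w w' : AffineTwistedInvolution n} (hw : w'.FixedPointFree) : w.hMat i ≠ w'.hMinus i := by
  simpa using congr_hMat_ne_hMinus (w := w) h2 hi hw (one_mem (iwahori n 𝕜))

lemma hMat_injective {i : 𝕜} (hi : i ≠ 0) {w w' : AffineTwistedInvolution n}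
    (h : w.hMat i = w'.hMat i) : w = w' :=
  eq_of_congr_hMat hi (one_mem (iwahori n 𝕜)) (by simpa using h)

lemma hMinus_injective [NeZero n] {i : 𝕜} (hi : i ≠ 0) {w w' : AffineTwistedInvolution n}
    (h : w.hMinus i = w'.hMinus i) : w = w' :=
  eq_of_congr_hMinus hi (one_mem (iwahori n 𝕜)) (by simpa using h)

lemma isSymm_affineMonomial (w : AffineTwistedInvolution n) {κ : Fin n → 𝕜}
    (hκ : ∀ q, κ (w.perm q) = κ q) : (affineMonomial w.perm w.shift κ).IsSymm := by
  refine Matrix.IsSymm.ext fun p q => ?_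
  rw [affineMonomial_apply, affineMonomial_apply]
  by_cases h : q = w.perm p
  · subst h
    rw [if_pos rfl, if_pos (w.perm_perm p).symm, w.shift_perm, hκ]
  · rw [if_neg h, if_neg fun h' => h (by rw [h', w.perm_perm])]

/-- A permutation and exponents of an affine permutation matrix form an affine twisted involution
as soon as the determinant has order zero. -/
lemma exists_of_det {σ : Equiv.Perm (Fin n)} {c : Fin n → ℤ} {κ : Fin n → 𝕜}
    (hκ : ∀ q, κ q ≠ 0) (hσ : ∀ q, σ (σ q) = q) (hS : (affineMonomial σ c κ).IsSymm)
    (hdet : (affineMonomial σ c κ).det.order = 0) :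
    ∃ w : AffineTwistedInvolution n, w.perm = σ ∧ w.shift = c := by
  refine ⟨⟨σ, c, hσ, fun j => ?_, (det_affineMonomial σ c hκ).2 ▸ hdet⟩, rfl, rfl⟩
  have h := hS.apply j (σ j)
  have h' := affineMonomial_apply_self σ c κ (σ j)
  rw [hσ] at h'
  rw [affineMonomial_apply_self, h'] at h
  rw [← HahnSeries.order_single (hκ j) (a := c j), h, HahnSeries.order_single (hκ _)]

end AffineTwistedInvolution

open AffineTwistedInvolution

lemma mem_iSymAPM_of_eq_hMat [NeZero n] {i : 𝕜} (hi : i ≠ 0) {w : AffineTwistedInvolution n}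
    {h : Matrix.SpecialLinearGroup (Fin n) (LaurentSeries 𝕜)} (hw : h.1 = w.hMat i) :
    h ∈ iSymAPM n i := by
  have hne : ∀ p q, h.1 p q ≠ 0 → p = w.perm q := by
    intro p q hpq
    by_contra hc
    rw [hw, hMat, Matrix.of_apply, if_neg hc] at hpq
    exact hpq rfl
  have hoff : ∀ p q, p ≠ q → h.1 p q ≠ 0 → ∃ a : ℤ, h.1 p q = HahnSeries.C i * tpow 𝕜 a := by
    intro p q hpq h0
    refine ⟨w.shift q, ?_⟩
    rw [hw, hMat, Matrix.of_apply, if_pos (hne p q h0), if_neg hpq]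
  refine ⟨?_, ?_, fun _ => ⟨fun p h0 => ⟨w.shift p, ?_⟩, hoff⟩, fun hd => ⟨fun p q _ h0 => ?_,
    fun p q _ _ h0 => hoff p q ?_ h0⟩⟩
  · rw [hw, hMat_eq]
    exact isMonomial_affineMonomial _ _ (hCoeff_ne_zero hi w)
  · rw [hw, hMat_eq]
    exact isSymm_affineMonomial w (hCoeff_perm i w)
  · rw [hw, hMat, Matrix.of_apply, if_pos (hne p p h0), if_pos rfl]
  · obtain ⟨a, ha⟩ := hoff p q (by rintro rfl; exact h0 (hd p)) h0
    exact ⟨a, Or.inl ha⟩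
  · rintro rfl
    exact h0 (hd p)

lemma mem_iSymAPM_of_eq_hMinus [NeZero n] {i : 𝕜} (hi : i ≠ 0) {w : AffineTwistedInvolution n}
    (hf : w.FixedPointFree)
    {h : Matrix.SpecialLinearGroup (Fin n) (LaurentSeries 𝕜)} (hw : h.1 = w.hMinus i) :
    h ∈ iSymAPM n i := by
  have hent : ∀ p q, h.1 p q ≠ 0 → p = w.perm q ∧
      h.1 p q = HahnSeries.C (signAt 𝕜 p * signAt 𝕜 q) * (HahnSeries.C i * tpow 𝕜 (w.shift q)) := by
    intro p q h0
    rw [hw, hMinus_apply, hMat, Matrix.of_apply] at h0 ⊢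
    by_cases hpq : p = w.perm q
    · refine ⟨hpq, ?_⟩
      rw [if_pos hpq, if_neg (fun h => hf q (hpq ▸ h)), map_mul]
      ring
    · rw [if_neg hpq, mul_zero, zero_mul] at h0
      exact absurd rfl h0
  refine ⟨?_, ?_, fun ⟨p, h0⟩ => absurd (hent p p h0).1.symm (hf p),
    fun hd => ⟨fun p q _ h0 => ⟨w.shift q, ?_⟩, fun p q hp hq h0 => ⟨w.shift q, ?_⟩⟩⟩
  · rw [hw, hMinus_eq]
    exact isMonomial_affineMonomial _ _ fun q =>
      mul_ne_zero (mul_ne_zero (signAt_ne_zero _) (signAt_ne_zero _)) (hCoeff_ne_zero hi w q)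
  · rw [hw, hMinus_eq]
    refine isSymm_affineMonomial w fun q => ?_
    rw [hCoeff_perm, w.perm_perm, mul_comm (signAt 𝕜 q)]
  · rw [(hent p q h0).2, signAt, signAt]
    split_ifs <;> simp
  · rw [(hent p q h0).2, signAt, signAt, if_neg hp, if_neg hq]
    simp

lemma mem_iSymAPM_iff [NeZero n] {i : 𝕜} (hi : i ≠ 0)
    (h : Matrix.SpecialLinearGroup (Fin n) (LaurentSeries 𝕜)) :
    h ∈ iSymAPM n i ↔ ∃ w : AffineTwistedInvolution n,
      h.1 = w.hMat i ∨ (w.FixedPointFree ∧ h.1 = w.hMinus i) := by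
  constructor
  · rintro ⟨hM, hS, hfix, hfree⟩
    obtain ⟨σ, hσ, hsupp⟩ := exists_perm_of_isMonomial hM hS
    -- it is enough to find the exponents and the coefficients
    have key : ∀ (c : Fin n → ℤ) (κ : Fin n → 𝕜), (∀ q, κ q ≠ 0) →
        (∀ q, h.1 (σ q) q = HahnSeries.single (c q) (κ q)) →
        ∃ w : AffineTwistedInvolution n, w.perm = σ ∧ w.shift = c ∧
          h.1 = affineMonomial w.perm w.shift κ := by
      intro c κ hκ he
      have heq : h.1 = affineMonomial σ c κ := by
        ext1 p q
        rw [affineMonomial_apply]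
        by_cases hpq : p = σ q
        · rw [if_pos hpq, hpq, he]
        · rw [if_neg hpq]
          by_contra h0
          exact hpq ((hsupp p q).1 h0)
      obtain ⟨w, rfl, rfl⟩ := exists_of_det hκ hσ (heq ▸ hS)
        (by rw [← heq, h.2, HahnSeries.order_one])
      exact ⟨w, rfl, rfl, heq⟩
    by_cases hd : ∃ p, h.1 p p ≠ 0
    · have he : ∀ q, ∃ a : ℤ, h.1 (σ q) q = HahnSeries.single a (if σ q = q then 1 else i) := by
        intro q
        have h0 := (hsupp (σ q) q).2 rfl
        split_ifs with hq
        · obtain ⟨a, ha⟩ := (hfix hd).1 q (by rwa [hq] at h0)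
          exact ⟨a, by rw [hq, ha, tpow]⟩
        · obtain ⟨a, ha⟩ := (hfix hd).2 (σ q) q hq h0
          exact ⟨a, by rw [ha, C_mul_tpow]⟩
      choose c hc using he
      obtain ⟨w, rfl, rfl, hw⟩ := key c _ (fun q => by split_ifs <;> simp [hi]) hc
      exact ⟨w, Or.inl (by rw [hw, hMat_eq]; rfl)⟩
    · push Not at hd
      have hσf : ∀ q, σ q ≠ q := fun q hq => (hsupp q q).2 hq.symm (hd q)
      have hrest : ∀ q, q ≠ 0 → σ q ≠ 0 → ∃ a : ℤ, h.1 (σ q) q = HahnSeries.single a i := by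
        intro q hq hq'
        obtain ⟨a, ha⟩ := (hfree hd).2 (σ q) q hq' hq ((hsupp _ _).2 rfl)
        exact ⟨a, by rw [ha, C_mul_tpow]⟩
      have hσ0 : h.1 (σ (σ 0)) (σ 0) = h.1 (σ 0) 0 := by rw [hσ, hS.apply]
      have hcase : ∀ q, q = 0 ∨ q = σ 0 ∨ (q ≠ 0 ∧ σ q ≠ 0) := by
        intro q
        by_cases h1 : q = 0
        · exact Or.inl h1
        · by_cases h2 : σ q = 0
          · exact Or.inr (Or.inl (by rw [← h2, hσ]))
          · exact Or.inr (Or.inr ⟨h1, h2⟩)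
      obtain ⟨a, ha | ha⟩ := (hfree hd).1 (σ 0) 0 (Or.inr rfl) ((hsupp _ _).2 rfl)
      · rw [C_mul_tpow] at ha
        have he : ∀ q, ∃ a : ℤ, h.1 (σ q) q = HahnSeries.single a i := by
          intro q
          rcases hcase q with rfl | rfl | ⟨h1, h2⟩
          · exact ⟨a, ha⟩
          · exact ⟨a, hσ0.trans ha⟩
          · exact hrest q h1 h2
        choose c hc using he
        obtain ⟨w, rfl, rfl, hw⟩ := key c _ (fun _ => hi) hc
        refine ⟨w, Or.inl ?_⟩
        rw [hw, hMat_eq]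
        congr 1
        funext q
        rw [hCoeff, if_neg (hσf q)]
      · rw [← neg_mul, ← map_neg, C_mul_tpow] at ha
        have he : ∀ q, ∃ a : ℤ, h.1 (σ q) q =
            HahnSeries.single a (signAt 𝕜 (σ q) * signAt 𝕜 q * i) := by
          intro q
          rcases hcase q with rfl | rfl | ⟨h1, h2⟩
          · exact ⟨a, by rw [ha, signAt, signAt, if_neg (hσf 0), if_pos rfl]; simp⟩
          · exact ⟨a, by rw [hσ0, ha, hσ, signAt, signAt, if_neg (hσf 0), if_pos rfl]; simp⟩
          · obtain ⟨a', ha'⟩ := hrest q h1 h2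
            exact ⟨a', by rw [ha', signAt, signAt, if_neg h1, if_neg h2]; simp⟩
        choose c hc using he
        obtain ⟨w, rfl, rfl, hw⟩ := key c _ (fun q => mul_ne_zero
          (mul_ne_zero (signAt_ne_zero _) (signAt_ne_zero _)) hi) hc
        refine ⟨w, Or.inr ⟨hσf, ?_⟩⟩
        rw [hw, hMinus_eq]
        congr 1
        funext q
        rw [hCoeff, if_neg (hσf q)]
  · rintro ⟨w, hw | ⟨hf, hw⟩⟩
    · exact mem_iSymAPM_of_eq_hMat hi hw
    · exact mem_iSymAPM_of_eq_hMinus hi hf hw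

end Classification

/-! ### The explicit representatives -/

section Blocks

variable {n : ℕ} {R : Type*} [Field R] {τ : Fin n → Fin n} {M : Matrix (Fin n) (Fin n) R}

/-- The determinant of a matrix that is block diagonal with blocks of sizes one and two, the blocks
being the orbits of an involution `τ`. Subtracting from the second column of each block the multiple
of the first that makes it lower triangular leaves the stated pivots. -/
lemma det_of_involutive_blocks (hτ : ∀ q, τ (τ q) = q)
    (hM : ∀ p q, p ≠ q → p ≠ τ q → M p q = 0)
    (hne : ∀ q, τ q < q → M (τ q) (τ q) ≠ 0) :
    M.det = ∏ q, if τ q < q then M q q - M q (τ q) * M (τ q) q / M (τ q) (τ q) else M q q := by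
  set U : Matrix (Fin n) (Fin n) R := Matrix.of fun p q =>
    if p = q then 1 else if p = τ q ∧ p < q then -(M p q / M p p) else 0 with hU
  have hUtri : U.IsUpperTriangular := by
    intro p q hpq
    have hpq : q < p := hpq
    rw [hU, Matrix.of_apply, if_neg hpq.ne', if_neg fun h => hpq.asymm h.2]
  have hdetU : U.det = 1 := by
    rw [Matrix.det_of_isUpperTriangular hUtri]
    exact Finset.prod_eq_one fun q _ => by simp [hU]
  have hMU : ∀ p q, (M * U) p q = M p q - if τ q < q then
      M p (τ q) * M (τ q) q / M (τ q) (τ q) else 0 := by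
    intro p q
    rw [Matrix.mul_apply]
    by_cases h : τ q < q
    · rw [if_pos h, Fintype.sum_eq_add q (τ q) h.ne']
      · rw [hU, Matrix.of_apply, Matrix.of_apply, if_pos rfl, if_neg h.ne, if_pos ⟨rfl, h⟩]
        ring
      · rintro r ⟨h1, h2⟩
        rw [hU, Matrix.of_apply, if_neg h1, if_neg fun h => h2 h.1, mul_zero]
    · rw [if_neg h, Fintype.sum_eq_single q]
      · rw [hU, Matrix.of_apply, if_pos rfl, mul_one, sub_zero]
      · intro r h1
        rw [hU, Matrix.of_apply, if_neg h1, if_neg, mul_zero]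
        rintro ⟨rfl, h2⟩
        exact h h2
  have hlow : (M * U).IsLowerTriangular := by
    intro p q hpq
    have hpq : p < q := hpq
    rw [hMU]
    by_cases h : τ q < q
    · rw [if_pos h]
      by_cases hp : p = τ q
      · subst hp
        field_simp [hne q h]
        ring
      · rw [hM p q hpq.ne hp, hM p (τ q) hp (by rw [hτ]; exact hpq.ne)]
        simp
    · rw [if_neg h, sub_zero]
      refine hM p q hpq.ne ?_
      rintro rfl
      exact h hpq
  rw [← mul_one M.det, ← hdetU, ← Matrix.det_mul, Matrix.det_of_isLowerTriangular _ hlow]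
  refine Finset.prod_congr rfl fun q _ => ?_
  rw [hMU]
  split_ifs <;> simp

/-- The Gram matrix of the columns of a block diagonal matrix with blocks of sizes one and two. -/
lemma transpose_mul_self_of_involutive_blocks (hτ : ∀ q, τ (τ q) = q)
    (hM : ∀ p q, p ≠ q → p ≠ τ q → M p q = 0) (p q : Fin n) :
    (Mᵀ * M) p q = if p = q then (if τ q = q then M q q ^ 2 else M q q ^ 2 + M (τ q) q ^ 2)
      else if p = τ q then M q p * M q q + M p p * M p q else 0 := by
  rw [Matrix.mul_apply]
  simp only [Matrix.transpose_apply]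
  split_ifs with h1 h2 h2
  · subst h1
    rw [Fintype.sum_eq_single p fun r hr => by rw [hM r p hr (by rwa [h2]), zero_mul], pow_two]
  · subst h1
    rw [Fintype.sum_eq_add p (τ p) (Ne.symm h2) fun r hr => by rw [hM r p hr.1 hr.2, zero_mul],
      pow_two, pow_two]
  · subst h2
    exact Fintype.sum_eq_add q (τ q) (Ne.symm h1) fun r hr => by rw [hM r q hr.1 hr.2, mul_zero]
  · refine Finset.sum_eq_zero fun r _ => ?_
    by_cases h3 : r = q ∨ r = τ q
    · rw [hM r p, zero_mul]
      · rcases h3 with rfl | rfl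
        · exact Ne.symm h1
        · exact Ne.symm h2
      · rcases h3 with rfl | rfl
        · intro h; exact h2 (by rw [h, hτ])
        · intro h; exact h1 (by rw [← hτ p, ← h, hτ])
    · push Not at h3
      rw [hM r q h3.1 h3.2, mul_zero]

end Blocks

section Pairing

/-- In a finite set of even cardinality, listed increasingly, each element has a partner: the first
is paired with the second, the third with the fourth, and so on. -/
lemma exists_partner {n : ℕ} (S : Finset (Fin n)) (hS : Even S.card) {q : Fin n} (hq : q ∈ S) :
    ∃ p ∈ S, p ≠ q ∧ ∀ r, (r ∈ S ∧
      (S.filter fun j => j < r).card / 2 = (S.filter fun j => j < q).card / 2) ↔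
        r = q ∨ r = p := by
  set rk : Fin n → ℕ := fun r => (S.filter fun j => j < r).card with hrk
  have hmono : ∀ a ∈ S, ∀ b, a < b → rk a < rk b := by
    intro a ha b hab
    refine Finset.card_lt_card ⟨fun j hj => ?_, fun h => ?_⟩
    · rw [Finset.mem_filter] at hj ⊢
      exact ⟨hj.1, hj.2.trans hab⟩
    · have := h (Finset.mem_filter.2 ⟨ha, hab⟩)
      exact lt_irrefl a (Finset.mem_filter.1 this).2
  have hinj : Set.InjOn rk S := by
    intro a ha b hb hab
    rcases lt_trichotomy a b with h | h | h
    · exact absurd hab (hmono a ha b h).ne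
    · exact h
    · exact absurd hab (hmono b hb a h).ne'
  have hlt : ∀ a ∈ S, rk a < S.card := by
    intro a ha
    refine Finset.card_lt_card ⟨Finset.filter_subset _ _, fun h => ?_⟩
    exact lt_irrefl a (Finset.mem_filter.1 (h ha)).2
  have hsurj : Set.SurjOn rk S (Finset.range S.card) :=
    Finset.surjOn_of_injOn_of_card_le rk
      (fun a ha => Finset.mem_coe.2 (Finset.mem_range.2 (hlt a ha))) hinj (by simp)
  have hget : ∀ m < S.card, ∃ a ∈ S, rk a = m := by
    intro m hm
    obtain ⟨a, ha, h⟩ := hsurj (Finset.mem_coe.2 (Finset.mem_range.2 hm))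
    exact ⟨a, ha, h⟩
  have hqlt := hlt q hq
  obtain ⟨N, hN⟩ := hS
  obtain ⟨m, hm, hmne, hmq⟩ : ∃ m < S.card, m ≠ rk q ∧
      ∀ k, k / 2 = rk q / 2 ↔ k = rk q ∨ k = m := by
    rcases Nat.even_or_odd' (rk q) with ⟨l, hl | hl⟩
    · exact ⟨2 * l + 1, by omega, by omega, fun k => by omega⟩
    · exact ⟨2 * l, by omega, by omega, fun k => by omega⟩
  obtain ⟨p, hp, hpm⟩ := hget m hm
  refine ⟨p, hp, by rintro rfl; exact hmne hpm.symm, fun r => ⟨?_, ?_⟩⟩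
  · rintro ⟨hr, hr2⟩
    rcases (hmq (rk r)).1 hr2 with h | h
    · exact Or.inl (hinj hr hq h)
    · exact Or.inr (hinj hr hp (h.trans hpm.symm))
  · rintro (rfl | rfl)
    · exact ⟨hq, rfl⟩
    · exact ⟨hp, (hmq _).2 (Or.inr hpm)⟩

end Pairing

namespace AffineTwistedInvolution

variable {n : ℕ} {𝕜 : Type*} [Field 𝕜]

lemma mem_oddFixed {w : AffineTwistedInvolution n} {q : Fin n} :
    q ∈ w.oddFixed ↔ w.perm q = q ∧ Odd (w.shift q) := by
  simp [oddFixed]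

lemma even_card_oddFixed (w : AffineTwistedInvolution n) : Even w.oddFixed.card := by
  have h1 : ∑ q, (w.shift q : ZMod 2) = 0 := by
    rw [← Int.cast_sum, w.sum_shift, Int.cast_zero]
  have h2 : ∑ q ∈ w.oddFixed, (w.shift q : ZMod 2) = w.oddFixed.card := by
    rw [Finset.sum_congr rfl fun q hq =>
      (ZMod.intCast_eq_one_iff_odd).2 (mem_oddFixed.1 hq).2]
    simp
  have h3 : ∑ q ∈ Finset.univ \ w.oddFixed, (w.shift q : ZMod 2) = 0 := by
    refine Finset.sum_involution (fun q _ => w.perm q) (fun q _ => ?_) (fun q hq h0 hp => ?_)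
      (fun q hq => ?_) (fun q _ => w.perm_perm q)
    · rw [w.shift_perm]
      exact CharTwo.add_self_eq_zero _
    · refine (Finset.mem_sdiff.1 hq).2 (mem_oddFixed.2 ⟨hp, ?_⟩)
      rw [← Int.not_even_iff_odd]
      exact fun h => h0 ((ZMod.intCast_eq_zero_iff_even).2 h)
    · rw [Finset.mem_sdiff, mem_oddFixed] at hq ⊢
      refine ⟨Finset.mem_univ _, fun h => hq.2 ?_⟩
      rw [w.perm_perm, w.shift_perm] at h
      exact ⟨h.1.symm, h.2⟩
  rw [← Finset.sum_sdiff (Finset.subset_univ w.oddFixed), h3, h2, zero_add] at h1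
  exact (ZMod.natCast_eq_zero_iff_even).1 h1

/-- An involution whose orbits are the blocks of `g_w`: it is the permutation of `w` off the fixed
points, fixes the fixed points with even exponent, and pairs those with odd exponent. -/
def IsBlockInvolution (w : AffineTwistedInvolution n) (τ : Fin n → Fin n) : Prop :=
  (∀ q, τ (τ q) = q) ∧ (∀ q, w.perm q ≠ q → τ q = w.perm q) ∧
    (∀ q, w.perm q = q → w.perm (τ q) = τ q) ∧
    (∀ q, w.perm q = q → Even (w.shift q) → τ q = q) ∧
    ∀ q, w.perm q = q → ¬Even (w.shift q) → τ q ≠ q ∧ ¬Even (w.shift (τ q)) ∧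
      ∀ p, (p ∈ w.oddFixed ∧ w.oddRank p / 2 = w.oddRank q / 2) ↔ p = q ∨ p = τ q

lemma exists_blockInvolution (w : AffineTwistedInvolution n) :
    ∃ τ : Fin n → Fin n, w.IsBlockInvolution τ := by
  have hex : ∀ q, ∃ p, (w.perm q ≠ q → p = w.perm q) ∧
      (w.perm q = q → Even (w.shift q) → p = q) ∧
      (w.perm q = q → ¬Even (w.shift q) → p ≠ q ∧ p ∈ w.oddFixed ∧
        ∀ r, (r ∈ w.oddFixed ∧ w.oddRank r / 2 = w.oddRank q / 2) ↔ r = q ∨ r = p) := by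
    intro q
    by_cases h1 : w.perm q = q
    · by_cases h2 : Even (w.shift q)
      · exact ⟨q, fun h => absurd h1 h, fun _ _ => rfl, fun _ h => absurd h2 h⟩
      · obtain ⟨p, hp, hpq, hr⟩ := exists_partner w.oddFixed w.even_card_oddFixed
          (mem_oddFixed.2 ⟨h1, Int.not_even_iff_odd.1 h2⟩)
        exact ⟨p, fun h => absurd h1 h, fun _ h => absurd h h2, fun _ _ => ⟨hpq, hp, hr⟩⟩
    · exact ⟨w.perm q, fun _ => rfl, fun h => absurd h h1, fun h => absurd h h1⟩
  choose τ h1 h2 h3 using hex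
  refine ⟨τ, fun q => ?_, h1, fun q hq => ?_, h2, fun q hq hq' => ?_⟩
  · by_cases hq : w.perm q = q
    · by_cases hq' : Even (w.shift q)
      · rw [h2 q hq hq', h2 q hq hq']
      · obtain ⟨hne, hmem, hr⟩ := h3 q hq hq'
        obtain ⟨ha, hb⟩ := mem_oddFixed.1 hmem
        obtain ⟨-, -, hr'⟩ := h3 (τ q) ha (Int.not_even_iff_odd.2 hb)
        have hqq := (hr' q).1 ⟨mem_oddFixed.2 ⟨hq, Int.not_even_iff_odd.1 hq'⟩,
          ((hr (τ q)).2 (Or.inr rfl)).2.symm⟩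
        rcases hqq with h | h
        · exact absurd h.symm hne
        · exact h.symm
    · rw [h1 q hq, h1 _ (by rw [w.perm_perm]; exact Ne.symm hq), w.perm_perm]
  · by_cases hq' : Even (w.shift q)
    · rw [h2 q hq hq', hq]
    · exact (mem_oddFixed.1 (h3 q hq hq').2.1).1
  · obtain ⟨hne, hmem, hr⟩ := h3 q hq hq'
    exact ⟨hne, Int.not_even_iff_odd.2 (mem_oddFixed.1 hmem).2, hr⟩

section Representatives

variable {i : 𝕜} {s : LaurentSeries 𝕜} {w : AffineTwistedInvolution n} {τ : Fin n → Fin n}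

lemma gMat_of_even {q : Fin n} (h1 : w.perm q = q) (h2 : Even (w.shift q)) (p : Fin n) :
    w.gMat i s p q = if p = q then tpow 𝕜 (w.shift q / 2) else 0 := by
  rw [gMat, Matrix.of_apply, if_pos h1, if_pos h2]

lemma gMat_of_odd {q q' : Fin n} (h1 : w.perm q = q) (h2 : ¬Even (w.shift q))
    (h : ∀ p, (p ∈ w.oddFixed ∧ w.oddRank p / 2 = w.oddRank q / 2) ↔ p = q ∨ p = q')
    (p : Fin n) :
    w.gMat i s p q = if p = q ∨ p = q' then
      if p = q then tpow 𝕜 ((w.shift q - 1) / 2)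
        else if p < q then -(s * tpow 𝕜 ((w.shift q - 1) / 2))
        else s * tpow 𝕜 ((w.shift q - 1) / 2)
      else 0 := by
  rw [gMat, Matrix.of_apply, if_pos h1, if_neg h2]
  simp only [h]

lemma gMat_of_lt {q : Fin n} (h : q < w.perm q) (p : Fin n) :
    w.gMat i s p q = if p = q then tpow 𝕜 (w.shift q) / 2
      else if p = w.perm q then HahnSeries.C i * tpow 𝕜 (w.shift q) / 2 else 0 := by
  rw [gMat, Matrix.of_apply, if_neg h.ne', if_pos h]

lemma gMat_of_gt {q : Fin n} (h : w.perm q < q) (p : Fin n) :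
    w.gMat i s p q = if p = w.perm q then HahnSeries.C i else if p = q then 1 else 0 := by
  rw [gMat, Matrix.of_apply, if_neg h.ne, if_neg h.asymm]

lemma gMat_apply_eq_zero (hb : w.IsBlockInvolution τ) (p q : Fin n) (h1 : p ≠ q)
    (h2 : p ≠ τ q) : w.gMat i s p q = 0 := by
  obtain ⟨hτ, hcyc, hfix, heven, hodd⟩ := hb
  by_cases hq : w.perm q = q
  · by_cases he : Even (w.shift q)
    · rw [gMat_of_even hq he, if_neg h1]
    · rw [gMat_of_odd hq he (hodd q hq he).2.2, if_neg]
      tauto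
  · rw [hcyc q hq] at h2
    rcases lt_or_gt_of_ne hq with h | h
    · rw [gMat_of_gt h, if_neg h2, if_neg h1]
    · rw [gMat_of_lt h, if_neg h1, if_neg h2]

lemma gMat_transpose_mul_self (h2 : (2 : 𝕜) ≠ 0) (hi : i ^ 2 = -1)
    (hs : s ^ 2 = tpow 𝕜 1 - 1) (w : AffineTwistedInvolution n) :
    (w.gMat i s)ᵀ * w.gMat i s = w.hMat i := by
  obtain ⟨τ, hb⟩ := w.exists_blockInvolution
  obtain ⟨hτ, hcyc, hfix, heven, hodd⟩ := id hb
  have hi' := C_mul_self (𝕜 := 𝕜) hi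
  have h2' := two_ne_zero_laurentSeries h2
  have hsupp := gMat_apply_eq_zero (i := i) (s := s) hb
  have htp : ∀ q, ¬Even (w.shift q) →
      tpow 𝕜 ((w.shift q - 1) / 2) ^ 2 * tpow 𝕜 1 = tpow 𝕜 (w.shift q) := by
    intro q hq
    obtain ⟨k, hk⟩ := Int.not_even_iff_odd.1 hq
    rw [pow_two, tpow_mul_tpow, tpow_mul_tpow]
    congr 1
    omega
  ext1 p q
  rw [transpose_mul_self_of_involutive_blocks hτ hsupp, hMat, Matrix.of_apply]
  by_cases hpq : p = q
  · subst hpq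
    rw [if_pos rfl]
    by_cases hq : w.perm p = p
    · rw [if_pos hq.symm, if_pos rfl]
      by_cases he : Even (w.shift p)
      · rw [if_pos (heven p hq he), gMat_of_even hq he, if_pos rfl, pow_two, tpow_mul_tpow]
        obtain ⟨k, hk⟩ := he
        congr 1
        omega
      · obtain ⟨hne, hoe, hr⟩ := hodd p hq he
        rw [if_neg hne, gMat_of_odd hq he hr, gMat_of_odd hq he hr, if_pos (Or.inl rfl),
          if_pos rfl, if_pos (Or.inr rfl), if_neg hne, ← htp p he]
        split_ifs <;> linear_combination (tpow 𝕜 ((w.shift p - 1) / 2)) ^ 2 * hs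
    · rw [if_neg (Ne.symm hq), hcyc p hq, if_neg hq]
      rcases lt_or_gt_of_ne hq with h | h
      · rw [gMat_of_gt h, gMat_of_gt h, if_neg h.ne', if_pos rfl, if_pos rfl]
        linear_combination hi'
      · rw [gMat_of_lt h, gMat_of_lt h, if_pos rfl, if_neg h.ne', if_pos rfl]
        linear_combination (tpow 𝕜 (w.shift p) / 2) ^ 2 * hi'
  · rw [if_neg hpq, if_neg hpq]
    by_cases hq : w.perm q = q
    · rw [hq, if_neg hpq]
      split_ifs with hp
      · subst hp
        have he : ¬Even (w.shift q) := fun he => hpq (heven q hq he)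
        obtain ⟨hne, hoe, hr⟩ := hodd q hq he
        obtain ⟨-, -, hr'⟩ := hodd (τ q) (hfix q hq) hoe
        rw [hτ] at hr'
        simp only [gMat_of_odd hq he hr, gMat_of_odd (hfix q hq) hoe hr', if_true, true_or, or_true,
          if_neg hne, if_neg (Ne.symm hne)]
        rcases lt_or_gt_of_ne hne with h | h
        · rw [if_neg h.asymm, if_pos h]; ring
        · rw [if_neg h.asymm, if_pos h]; ring
      · rfl
    · rw [hcyc q hq]
      by_cases hp : p = w.perm q
      · subst hp
        rw [if_pos rfl, if_pos rfl]
        rcases lt_or_gt_of_ne hq with h | h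
        · have h' : w.perm q < w.perm (w.perm q) := by rwa [w.perm_perm]
          rw [gMat_of_gt h, gMat_of_gt h, gMat_of_lt h', gMat_of_lt h', w.perm_perm, w.shift_perm]
          simp only [if_true, if_neg h.ne, if_neg h.ne']
          field_simp
          ring
        · have h' : w.perm (w.perm q) < w.perm q := by rwa [w.perm_perm]
          rw [gMat_of_lt h, gMat_of_lt h, gMat_of_gt h', gMat_of_gt h', w.perm_perm]
          simp only [if_true, if_neg h.ne, if_neg h.ne']
          field_simp
          ring
      · rw [if_neg hp, if_neg hp]

/-- The pivots of `g_w` are powers of `t` up to the factors `1 / 2` and `2` from the two-cycles,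
which cancel; the exponents add up to half the sum of the exponents of `w`, that is, to zero. -/
lemma det_gMat (h2 : (2 : 𝕜) ≠ 0) (hi : i ^ 2 = -1)
    (hs : s ^ 2 = tpow 𝕜 1 - 1) (w : AffineTwistedInvolution n) :
    (w.gMat i s).det = 1 := by
  obtain ⟨τ, hb⟩ := w.exists_blockInvolution
  obtain ⟨hτ, hcyc, hfix, heven, hodd⟩ := id hb
  have hi' := C_mul_self (𝕜 := 𝕜) hi
  have h2' := two_ne_zero_laurentSeries h2
  have hsupp := gMat_apply_eq_zero (i := i) (s := s) hb
  have hne : ∀ q, τ q < q → w.gMat i s (τ q) (τ q) ≠ 0 := by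
    intro q h
    by_cases hq : w.perm q = q
    · have he : ¬Even (w.shift q) := fun he => h.ne (heven q hq he)
      obtain ⟨hne, hoe, hr⟩ := hodd q hq he
      obtain ⟨-, -, hr'⟩ := hodd (τ q) (hfix q hq) hoe
      rw [gMat_of_odd (hfix q hq) hoe hr', if_pos (Or.inl rfl), if_pos rfl]
      exact tpow_ne_zero _
    · rw [hcyc q hq] at h ⊢
      rw [gMat_of_lt (by rwa [w.perm_perm]), if_pos rfl]
      exact div_ne_zero (tpow_ne_zero _) h2'
  set κ : Fin n → LaurentSeries 𝕜 := fun q =>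
    if w.perm q = q then 1 else if w.perm q < q then 2 else 1 / 2 with hκ
  set e : Fin n → ℤ := fun q =>
    if w.perm q = q then if Even (w.shift q) then w.shift q / 2
      else if τ q < q then (w.shift q - 1) / 2 + 1 else (w.shift q - 1) / 2
    else if w.perm q < q then 0 else w.shift q with he
  have hpiv : ∀ q, (if τ q < q then w.gMat i s q q - w.gMat i s q (τ q) * w.gMat i s (τ q) q /
      w.gMat i s (τ q) (τ q) else w.gMat i s q q) = κ q * tpow 𝕜 (e q) := by
    intro q
    simp only [hκ, he]
    by_cases hq : w.perm q = q
    · rw [if_pos hq, if_pos hq, one_mul]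
      by_cases hev : Even (w.shift q)
      · rw [if_pos hev, heven q hq hev, if_neg (lt_irrefl q), gMat_of_even hq hev, if_pos rfl]
      · rw [if_neg hev]
        obtain ⟨hne', hoe, hr⟩ := hodd q hq hev
        obtain ⟨-, -, hr'⟩ := hodd (τ q) (hfix q hq) hoe
        rw [hτ] at hr'
        simp only [gMat_of_odd hq hev hr, gMat_of_odd (hfix q hq) hoe hr', if_true, true_or,
          or_true, if_neg hne', if_neg (Ne.symm hne')]
        split_ifs with h h'
        · exact absurd h' h.asymm
        · rw [← tpow_mul_tpow]
          have := tpow_ne_zero (𝕜 := 𝕜) ((w.shift (τ q) - 1) / 2)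
          field_simp
          linear_combination tpow 𝕜 ((w.shift q - 1) / 2) * hs
        · rfl
    · rw [if_neg hq, if_neg hq, hcyc q hq]
      rcases lt_or_gt_of_ne hq with h | h
      · rw [if_pos h, if_pos h, if_pos h]
        have h' : w.perm q < w.perm (w.perm q) := by rwa [w.perm_perm]
        have := tpow_ne_zero (𝕜 := 𝕜) (w.shift q)
        rw [gMat_of_gt h, gMat_of_gt h, gMat_of_lt h', gMat_of_lt h', w.perm_perm, w.shift_perm]
        simp only [if_true, if_neg h.ne, if_neg h.ne', tpow_zero]
        field_simp
        linear_combination -hi'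
      · rw [if_neg h.asymm, if_neg h.asymm, if_neg h.asymm, gMat_of_lt h, if_pos rfl]
        ring
  have hκprod : ∏ q, κ q = 1 := by
    refine Finset.prod_involution (fun q _ => w.perm q) (fun q _ => ?_) (fun q _ h => ?_)
      (fun _ _ => Finset.mem_univ _) (fun q _ => w.perm_perm q)
    · simp only [hκ, w.perm_perm]
      by_cases hq : w.perm q = q
      · simp [hq]
      · rw [if_neg hq, if_neg (Ne.symm hq)]
        rcases lt_or_gt_of_ne hq with h | h
        · rw [if_pos h, if_neg h.asymm]; field_simp
        · rw [if_neg h.asymm, if_pos h]; field_simp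
    · intro hq
      exact h (by simp only [hκ]; rw [if_pos hq])
  have hesum : ∑ q, e q = 0 := by
    have hdiff : ∑ q, (2 * e q - w.shift q) = 0 := by
      refine Finset.sum_involution (fun q _ => τ q) (fun q _ => ?_) (fun q _ h => ?_)
        (fun _ _ => Finset.mem_univ _) (fun q _ => hτ q)
      · simp only [he, hτ]
        by_cases hq : w.perm q = q
        · rw [if_pos hq, if_pos (hfix q hq)]
          by_cases hev : Even (w.shift q)
          · rw [heven q hq hev]
            obtain ⟨k, hk⟩ := hev
            rw [if_pos ⟨k, hk⟩]
            omega
          · obtain ⟨hne', hoe, -⟩ := hodd q hq hev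
            rw [if_neg hev, if_neg hoe]
            obtain ⟨k, hk⟩ := Int.not_even_iff_odd.1 hev
            obtain ⟨l, hl⟩ := Int.not_even_iff_odd.1 hoe
            rcases lt_or_gt_of_ne hne' with h | h
            · rw [if_pos h, if_neg h.asymm]; omega
            · rw [if_neg h.asymm, if_pos h]; omega
        · rw [hcyc q hq, w.perm_perm, w.shift_perm, if_neg hq, if_neg (Ne.symm hq)]
          rcases lt_or_gt_of_ne hq with h | h
          · rw [if_pos h, if_neg h.asymm]; ring
          · rw [if_neg h.asymm, if_pos h]; ring
      · intro hq
        apply h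
        by_cases hp : w.perm q = q
        · have hev : Even (w.shift q) := by
            by_contra hev
            exact (hodd q hp hev).1 hq
          simp only [he]
          rw [if_pos hp, if_pos hev]
          obtain ⟨k, hk⟩ := hev
          omega
        · rw [hcyc q hp] at hq
          exact absurd hq hp
    rw [Finset.sum_sub_distrib, w.sum_shift, ← Finset.mul_sum] at hdiff
    omega
  rw [det_of_involutive_blocks hτ hsupp hne, Finset.prod_congr rfl fun q _ => hpiv q,
    Finset.prod_mul_distrib, hκprod, tpow_sum, hesum, tpow_zero, one_mul]

/-- Up to signs, `g_w⁻` arises from `g_w⁺` by interchanging the columns of the first two-cycle. -/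
lemma gMinus_apply [NeZero n] (hw : w.FixedPointFree) (p q : Fin n) :
    w.gMinus i s p q = (if q = w.perm 0 then -1 else 1) *
      w.gMat i s p (Equiv.swap 0 (w.perm 0) q) := by
  have h0 : 0 < w.perm 0 := Fin.pos_iff_ne_zero.2 (hw 0)
  rw [gMinus, Matrix.of_apply]
  by_cases h : q = 0
  · subst h
    rw [if_pos rfl, if_neg h0.ne, Equiv.swap_apply_left, gMat_of_gt (by rwa [w.perm_perm]),
      w.perm_perm, one_mul]
  · rw [if_neg h]
    by_cases h' : q = w.perm 0
    · rw [if_pos h', if_pos h', h', Equiv.swap_apply_right, gMat_of_lt h0]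
      split_ifs <;> simp
    · rw [if_neg h', if_neg h', Equiv.swap_apply_of_ne_of_ne h h', one_mul]

lemma det_gMinus [NeZero n] (h2 : (2 : 𝕜) ≠ 0) (hi : i ^ 2 = -1)
    (hs : s ^ 2 = tpow 𝕜 1 - 1) (hw : w.FixedPointFree) : (w.gMinus i s).det = 1 := by
  have h : w.gMinus i s = Matrix.of fun p q => (if q = w.perm 0 then -1 else 1) *
      ((w.gMat i s).submatrix id (Equiv.swap 0 (w.perm 0))) p q := by
    ext1 p q
    exact gMinus_apply hw p q
  rw [h, Matrix.det_mul_row, Matrix.det_permute', det_gMat h2 hi hs,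
    Equiv.Perm.sign_swap (Ne.symm (hw 0))]
  simp [Finset.prod_ite_eq']

lemma gMinus_transpose_mul_self [NeZero n] (h2 : (2 : 𝕜) ≠ 0) (hi : i ^ 2 = -1)
    (hs : s ^ 2 = tpow 𝕜 1 - 1) (hw : w.FixedPointFree) :
    (w.gMinus i s)ᵀ * w.gMinus i s = w.hMinus i := by
  set π := Equiv.swap 0 (w.perm 0) with hπ
  have hcases : ∀ q, (q = 0 ∧ π q = w.perm 0) ∨ (q = w.perm 0 ∧ π q = 0) ∨
      (q ≠ 0 ∧ q ≠ w.perm 0 ∧ π q = q) := by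
    intro q
    by_cases h : q = 0
    · exact Or.inl ⟨h, by rw [h, hπ, Equiv.swap_apply_left]⟩
    · by_cases h' : q = w.perm 0
      · exact Or.inr (Or.inl ⟨h', by rw [h', hπ, Equiv.swap_apply_right]⟩)
      · exact Or.inr (Or.inr ⟨h, h', Equiv.swap_apply_of_ne_of_ne h h'⟩)
  have hcomm : ∀ q, w.perm (π q) = π (w.perm q) := by
    intro q
    rcases hcases q with ⟨rfl, h⟩ | ⟨rfl, h⟩ | ⟨h1, h2, h⟩
    · rw [h, w.perm_perm, hπ, Equiv.swap_apply_right]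
    · rw [h, w.perm_perm, hπ, Equiv.swap_apply_left]
    · rw [h, hπ, Equiv.swap_apply_of_ne_of_ne]
      · intro h'; exact h2 (by rw [← h', w.perm_perm])
      · intro h'; exact h1 (w.perm.injective h')
  have hshift : ∀ q, w.shift (π q) = w.shift q := by
    intro q
    rcases hcases q with ⟨rfl, h⟩ | ⟨rfl, h⟩ | ⟨-, -, h⟩
    · rw [h, w.shift_perm]
    · rw [h, w.shift_perm]
    · rw [h]
  have hh : ∀ p q, w.hMat i (π p) (π q) = w.hMat i p q := by
    intro p q
    rw [hMat, Matrix.of_apply, Matrix.of_apply, hcomm, hshift]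
    simp only [π.injective.eq_iff]
  ext1 p q
  have hentry : ((w.gMinus i s)ᵀ * w.gMinus i s) p q =
      (if p = w.perm 0 then -1 else 1) * (if q = w.perm 0 then -1 else 1) * w.hMat i p q := by
    rw [← hh, ← gMat_transpose_mul_self h2 hi hs, Matrix.mul_apply, Matrix.mul_apply,
      Finset.mul_sum]
    refine Finset.sum_congr rfl fun r _ => ?_
    rw [Matrix.transpose_apply, Matrix.transpose_apply, gMinus_apply hw, gMinus_apply hw]
    ring
  rw [hentry, hMinus_apply]
  by_cases hpq : p = w.perm q
  · have h0 := hw 0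
    have hq0 : w.perm q = w.perm 0 ↔ q = 0 := w.perm.injective.eq_iff
    have hq1 : w.perm q = 0 ↔ q = w.perm 0 :=
      ⟨fun h => by rw [← h, w.perm_perm], fun h => by rw [h, w.perm_perm]⟩
    rw [hpq, signAt, signAt]
    simp only [hq0, hq1]
    split_ifs <;> simp
  · rw [hMat, Matrix.of_apply, if_neg hpq]
    simp

end Representatives

end AffineTwistedInvolution

/-! ### Reduction to monomial form -/

section Reduction

variable {n : ℕ} {𝕜 : Type*} [Field 𝕜]

/-- The unit group of the Iwahori order, without the condition on the determinant that defines the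
Iwahori subgroup. -/
def IsIwahoriUnit (b : Matrix (Fin n) (Fin n) (LaurentSeries 𝕜)) : Prop :=
  InIwahoriOrder b ∧ b.det ≠ 0 ∧ b.det.order = 0

lemma IsIwahoriUnit.mul {a b : Matrix (Fin n) (Fin n) (LaurentSeries 𝕜)}
    (ha : IsIwahoriUnit a) (hb : IsIwahoriUnit b) : IsIwahoriUnit (a * b) := by
  refine ⟨ha.1.mul hb.1, ?_, ?_⟩
  · rw [Matrix.det_mul]
    exact mul_ne_zero ha.2.1 hb.2.1
  · rw [Matrix.det_mul, HahnSeries.order_mul ha.2.1 hb.2.1, ha.2.2, hb.2.2, add_zero]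

lemma isIwahoriUnit_diagonal {d : Fin n → LaurentSeries 𝕜} (h0 : ∀ j, d j ≠ 0)
    (hd : ∀ j, (d j).order = 0) : IsIwahoriUnit (Matrix.diagonal d) := by
  have hprod : ∀ s : Finset (Fin n), (∏ j ∈ s, d j).order = 0 := by
    intro s
    induction s using Finset.induction_on with
    | empty => simp
    | insert j s hj ih =>
      rw [Finset.prod_insert hj, HahnSeries.order_mul (h0 j)
        (Finset.prod_ne_zero_iff.2 fun j _ => h0 j), hd, ih, add_zero]
  refine ⟨inIwahoriOrder_diagonal hd, ?_, ?_⟩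
  · rw [Matrix.det_diagonal]
    exact Finset.prod_ne_zero_iff.2 fun j _ => h0 j
  · rw [Matrix.det_diagonal, hprod]

/-- Congruence of matrices under the units of the Iwahori order. -/
def IwahoriCongr (X Y : Matrix (Fin n) (Fin n) (LaurentSeries 𝕜)) : Prop :=
  ∃ b, IsIwahoriUnit b ∧ Y = bᵀ * X * b

lemma IwahoriCongr.refl (X : Matrix (Fin n) (Fin n) (LaurentSeries 𝕜)) : IwahoriCongr X X := by
  refine ⟨Matrix.diagonal fun _ => 1, isIwahoriUnit_diagonal (by simp) (by simp), ?_⟩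
  simp

lemma IwahoriCongr.trans {X Y Z : Matrix (Fin n) (Fin n) (LaurentSeries 𝕜)}
    (h1 : IwahoriCongr X Y) (h2 : IwahoriCongr Y Z) : IwahoriCongr X Z := by
  obtain ⟨a, ha, rfl⟩ := h1
  obtain ⟨b, hb, rfl⟩ := h2
  refine ⟨a * b, ha.mul hb, ?_⟩
  rw [Matrix.transpose_mul]
  simp only [Matrix.mul_assoc]

lemma IwahoriCongr.det_ne_zero {X Y : Matrix (Fin n) (Fin n) (LaurentSeries 𝕜)}
    (h : IwahoriCongr X Y) (hX : X.det ≠ 0) : Y.det ≠ 0 := by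
  obtain ⟨b, hb, rfl⟩ := h
  rw [Matrix.det_mul, Matrix.det_mul, Matrix.det_transpose]
  exact mul_ne_zero (mul_ne_zero hb.2.1 hX) hb.2.1

/-- The matrix whose right multiplication adds `α q` times the column `r` to each column `q`. -/
def addColumn (r : Fin n) (α : Fin n → LaurentSeries 𝕜) :
    Matrix (Fin n) (Fin n) (LaurentSeries 𝕜) :=
  1 + Matrix.of fun p q => if p = r then α q else 0

lemma mul_addColumn_apply (X : Matrix (Fin n) (Fin n) (LaurentSeries 𝕜)) (r : Fin n)
    (α : Fin n → LaurentSeries 𝕜) (p q : Fin n) :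
    (X * addColumn r α) p q = X p q + α q * X p r := by
  rw [addColumn, Matrix.mul_add, Matrix.mul_one, Matrix.add_apply, Matrix.mul_apply,
    Fintype.sum_eq_single r]
  · rw [Matrix.of_apply, if_pos rfl, mul_comm]
  · intro j hj
    rw [Matrix.of_apply, if_neg hj, mul_zero]

lemma congr_addColumn_apply (X : Matrix (Fin n) (Fin n) (LaurentSeries 𝕜)) (r : Fin n)
    (α : Fin n → LaurentSeries 𝕜) (p q : Fin n) :
    ((addColumn r α)ᵀ * X * addColumn r α) p q =
      X p q + α q * X p r + α p * X r q + α p * α q * X r r := by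
  have h : ∀ p q, ((addColumn r α)ᵀ * X) p q = X p q + α p * X r q := by
    intro p q
    rw [← Matrix.transpose_transpose ((addColumn r α)ᵀ * X), Matrix.transpose_apply,
      Matrix.transpose_mul, Matrix.transpose_transpose, mul_addColumn_apply,
      Matrix.transpose_apply, Matrix.transpose_apply]
  rw [mul_addColumn_apply, h, h]
  ring

lemma isIwahoriUnit_addColumn {r : Fin n} {α : Fin n → LaurentSeries 𝕜} (hr : α r = 0)
    (hα : ∀ q : Fin n, WeightGE (n : ℤ) ((r : ℤ) - (q : ℤ)) (α q)) :
    IsIwahoriUnit (addColumn r α) := by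
  have hdet : (addColumn r α).det = 1 := by
    have h : addColumn r α = 1 + Matrix.replicateCol (Fin 1) (Pi.single r (1 : LaurentSeries 𝕜)) *
        Matrix.replicateRow (Fin 1) α := by
      ext1 p q
      simp [addColumn, Matrix.mul_apply, Pi.single_apply]
    rw [h]
    exact (Matrix.det_one_add_replicateCol_mul_replicateRow _ _).trans (by simp [hr])
  refine ⟨fun p q => ?_, by rw [hdet]; exact one_ne_zero, by rw [hdet, HahnSeries.order_one]⟩
  rw [addColumn, Matrix.add_apply, Matrix.of_apply]
  have h1 : InIwahoriOrder (1 : Matrix (Fin n) (Fin n) (LaurentSeries 𝕜)) := by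
    rw [← Matrix.diagonal_one]
    exact inIwahoriOrder_diagonal (by simp)
  refine (h1 p q).add ?_
  split_ifs with h
  · rw [h]; exact hα q
  · exact WeightGE.zero

/-- The rows with index in `S` have a single non-zero entry each, in a column with index in `S`. -/
def MonomialOn (X : Matrix (Fin n) (Fin n) (LaurentSeries 𝕜)) (S : Finset (Fin n)) : Prop :=
  ∀ p ∈ S, ∃ q ∈ S, X p q ≠ 0 ∧ ∀ r, r ≠ q → X p r = 0

lemma MonomialOn.apply_eq_zero {X : Matrix (Fin n) (Fin n) (LaurentSeries 𝕜)}
    {S : Finset (Fin n)} (hX : MonomialOn X S) {p r : Fin n} (hp : p ∈ S) (hr : r ∉ S) :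
    X p r = 0 := by
  obtain ⟨q, hq, -, h⟩ := hX p hp
  exact h r (by rintro rfl; exact hr hq)

/-- A symmetric matrix that is monomial on `S`, together with the lower bound `m` for the weights
`n * v(X p q) + p + q` of the entries outside `S`. Elements of the Iwahori order preserve such a
bound. -/
structure IsReduced (X : Matrix (Fin n) (Fin n) (LaurentSeries 𝕜)) (S : Finset (Fin n)) (m : ℤ) :
    Prop where
  isSymm : X.IsSymm
  monomialOn : MonomialOn X S
  weight : ∀ p ∉ S, ∀ q ∉ S, WeightGE (n : ℤ) (m - p - q) (X p q)

variable {X : Matrix (Fin n) (Fin n) (LaurentSeries 𝕜)} {S : Finset (Fin n)} {m : ℤ}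

lemma IsReduced.exists_addColumn (hX : IsReduced X S m) {r : Fin n} (hr : r ∉ S)
    {α : Fin n → LaurentSeries 𝕜} (hαr : α r = 0) (hαS : ∀ p ∈ S, α p = 0)
    (hα : ∀ q : Fin n, WeightGE (n : ℤ) ((r : ℤ) - (q : ℤ)) (α q)) :
    ∃ Y, IwahoriCongr X Y ∧ IsReduced Y S m ∧ ∀ p q, Y p q =
      X p q + α q * X p r + α p * X r q + α p * α q * X r r := by
  refine ⟨_, ⟨addColumn r α, isIwahoriUnit_addColumn hαr hα, rfl⟩, ⟨?_, fun p hp => ?_, ?_⟩,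
    congr_addColumn_apply X r α⟩
  · refine Matrix.IsSymm.ext fun p q => ?_
    rw [congr_addColumn_apply, congr_addColumn_apply, hX.isSymm.apply p q, hX.isSymm.apply p r,
      hX.isSymm.apply r q]
    ring
  · obtain ⟨q, hq, h1, h2⟩ := hX.monomialOn p hp
    have hrow : ∀ q, ((addColumn r α)ᵀ * X * addColumn r α) p q = X p q := by
      intro q
      rw [congr_addColumn_apply, hαS p hp, hX.monomialOn.apply_eq_zero hp hr]
      ring
    exact ⟨q, hq, by rwa [hrow], fun j hj => by rw [hrow, h2 j hj]⟩
  · intro p hp q hq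
    rw [congr_addColumn_apply]
    refine (((hX.weight p hp q hq).add ?_).add ?_).add ?_
    · exact ((hα q).mul (hX.weight p hp r hr)).mono (by linarith)
    · exact ((hα p).mul (hX.weight r hr q hq)).mono (by linarith)
    · exact (((hα p).mul (hα q)).mul (hX.weight r hr r hr)).mono (by linarith)

/-- A pivot on the diagonal is split off by clearing its row and column. -/
lemma IsReduced.exists_of_diagonal_pivot (hX : IsReduced X S m) {r : Fin n} (hr : r ∉ S)
    (h0 : X r r ≠ 0) (hm : n * (X r r).order = m - r - r) :
    ∃ Y, IwahoriCongr X Y ∧ Y.IsSymm ∧ MonomialOn Y (insert r S) := by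
  have hn : (0 : ℤ) < n := by have := r.isLt; omega
  have hS : ∀ p ∈ S, X r p = 0 := fun p hp => by
    rw [hX.isSymm.apply, hX.monomialOn.apply_eq_zero hp hr]
  obtain ⟨Y, hXY, hY, hYX⟩ := hX.exists_addColumn hr
    (α := fun q => if q = r then 0 else -(X r q / X r r)) (if_pos rfl)
    (fun p hp => by simp [hS p hp]) (fun q => by
      split_ifs
      · exact WeightGE.zero
      by_cases hq : q ∈ S
      · rw [hS q hq, zero_div]
        exact WeightGE.zero.neg
      · exact ((hX.weight r hr q hq).div hn h0 hm).neg.mono (by linarith))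
  refine ⟨Y, hXY, hY.isSymm, fun p hp => ?_⟩
  rcases Finset.mem_insert.1 hp with rfl | hp
  · refine ⟨p, Finset.mem_insert_self _ _, ?_, fun q hq => ?_⟩
    · rw [hYX]; simpa using h0
    · rw [hYX, if_neg hq, if_pos rfl]
      field_simp
      ring
  · obtain ⟨q, hq, h⟩ := hY.monomialOn p hp
    exact ⟨q, Finset.mem_insert_of_mem hq, h⟩

/-- Off the diagonal, a pivot `(r, p)` with `X r r = 0` is split off together with the second
diagonal entry `X p p`: first the row `r` is cleared, then the row `p`. -/
lemma IsReduced.exists_of_isotropic_pivot (h2 : (2 : 𝕜) ≠ 0) (hX : IsReduced X S m)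
    {r p : Fin n} (hr : r ∉ S) (hp : p ∉ S) (hrp : r ≠ p) (h0 : X r p ≠ 0)
    (hm : n * (X r p).order = m - r - p) (hrr : X r r = 0) :
    ∃ Y, IwahoriCongr X Y ∧ Y.IsSymm ∧ MonomialOn Y (insert r (insert p S)) := by
  have hn : (0 : ℤ) < n := by have := r.isLt; omega
  have h2' := two_ne_zero_laurentSeries h2
  have hS : ∀ q ∈ S, X r q = 0 := fun q hq => by
    rw [hX.isSymm.apply, hX.monomialOn.apply_eq_zero hq hr]
  obtain ⟨Y, hXY, hY, hYX⟩ := hX.exists_addColumn hp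
    (α := fun q => if q = p ∨ q = r then 0 else -(X r q / X r p)) (by simp)
    (fun q hq => by simp [hS q hq]) (fun q => by
      split_ifs
      · exact WeightGE.zero
      by_cases hq : q ∈ S
      · rw [hS q hq, zero_div]
        exact WeightGE.zero.neg
      · exact ((hX.weight r hr q hq).div hn h0 hm).neg.mono (by linarith))
  have hYrp : Y r p = X r p := by rw [hYX]; simp
  have hYr : ∀ q, q ≠ p → Y r q = 0 := by
    intro q hq
    rw [hYX, if_pos (Or.inr rfl : r = p ∨ r = r)]
    by_cases hqr : q = r
    · subst hqr
      rw [if_pos (Or.inr rfl), hrr]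
      ring
    · rw [if_neg (by tauto)]
      field_simp
      ring
  have hYpr : Y p r = X r p := by rw [hY.isSymm.apply, hYrp]
  have hYS : ∀ q ∈ S, Y p q = 0 := fun q hq => by
    rw [hY.isSymm.apply, hY.monomialOn.apply_eq_zero hq hp]
  have hm' : n * (Y p r).order = m - p - r := by rw [hYpr, hm]; ring
  have h0' : Y p r ≠ 0 := by rwa [hYpr]
  have hhalf : WeightGE (n : ℤ) 0 ((1 : LaurentSeries 𝕜) / 2) := by
    have h : (1 : LaurentSeries 𝕜) / 2 = HahnSeries.C (1 / 2 : 𝕜) := by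
      rw [map_div₀, map_one, map_ofNat]
    rw [h]
    exact weightGE_zero_of_order_eq_zero hn HahnSeries.order_C
  obtain ⟨Z, hYZ, hZ, hZY⟩ := hY.exists_addColumn hr
    (α := fun q => if q = r then 0 else if q = p then -(Y p p / Y p r * (1 / 2))
      else -(Y p q / Y p r)) (by simp)
    (fun q hq => by
      rw [if_neg (by rintro rfl; exact hr hq), if_neg (by rintro rfl; exact hp hq), hYS q hq]
      simp) (fun q => by
      split_ifs with hqr hqp
      · exact WeightGE.zero
      · subst hqp
        exact (((hY.weight q hp q hp).div hn h0' hm').mul hhalf).neg.mono (by linarith)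
      by_cases hq : q ∈ S
      · rw [hYS q hq, zero_div]
        exact WeightGE.zero.neg
      · exact ((hY.weight p hp q hq).div hn h0' hm').neg.mono (by linarith))
  refine ⟨Z, hXY.trans hYZ, hZ.isSymm, fun q hq => ?_⟩
  rcases Finset.mem_insert.1 hq with rfl | hq
  · refine ⟨p, by simp, ?_, fun j hj => ?_⟩
    · rw [hZY, hYr q hrp]; simpa [hYrp] using h0
    · rw [hZY, hYr q hrp, hYr j hj]; simp
  rcases Finset.mem_insert.1 hq with rfl | hq
  · refine ⟨r, by simp, ?_, fun j hj => ?_⟩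
    · rw [hZY, hYr r hrp]; simpa using h0'
    · rw [hZY, hYr r hrp]
      simp only [if_neg hj, if_neg (Ne.symm hrp), if_true]
      by_cases hjq : j = q
      · subst hjq
        rw [if_pos rfl, hYrp, hYpr]
        field_simp
        ring
      · rw [if_neg hjq, hYr j hjq]
        field_simp
        ring
  · obtain ⟨j, hj, h⟩ := hZ.monomialOn q hq
    exact ⟨j, by simp [hj], h⟩

/-- Solution of the quadratic equation `A + 2 α + α ^ 2 C = 0` whose coefficients have opposite
weight bounds `p - r` and `r - p` with `r ≠ p`. The bounds force `v(A C) > 0`, so the discriminant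
is a square, and the smaller root is `-A / (1 + √(1 - A C))`. -/
lemma exists_quadratic_root (h2 : (2 : 𝕜) ≠ 0) {r p : Fin n} (hrp : r ≠ p)
    {A C : LaurentSeries 𝕜} (hA : WeightGE (n : ℤ) ((p : ℤ) - (r : ℤ)) A)
    (hC : WeightGE (n : ℤ) ((r : ℤ) - (p : ℤ)) C) :
    ∃ α : LaurentSeries 𝕜, WeightGE (n : ℤ) ((p : ℤ) - (r : ℤ)) α ∧
      A + 2 * α + α ^ 2 * C = 0 ∧ 1 + α * C ≠ 0 ∧ (1 + α * C).order = 0 := by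
  have hn : (0 : ℤ) < n := by have := r.isLt; omega
  have hr := r.isLt
  have hp := p.isLt
  have hup : ∀ {a b : Fin n} {D : LaurentSeries 𝕜}, a < b →
      WeightGE (n : ℤ) ((b : ℤ) - (a : ℤ)) D → WeightGE (n : ℤ) n D := by
    intro a b D hab hD k hk
    have hk : k < 1 := by nlinarith
    have hk : k ≤ 0 := by omega
    rw [Fin.lt_def] at hab
    exact hD k (by nlinarith)
  have hdown : ∀ {a b : Fin n} {D : LaurentSeries 𝕜},
      WeightGE (n : ℤ) ((b : ℤ) - (a : ℤ)) D → WeightGE (n : ℤ) 0 D := by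
    intro a b D hD k hk
    have hk : k < 0 := by nlinarith
    have hk : k ≤ -1 := by omega
    have ha := a.isLt
    exact hD k (by nlinarith)
  have hAC : WeightGE (n : ℤ) n (A * C) := by
    rcases lt_or_gt_of_ne hrp with h | h
    · simpa using (hup h hA).mul (hdown hC)
    · simpa using (hdown hA).mul (hup h hC)
  have hunit : ∀ {x : LaurentSeries 𝕜}, WeightGE (n : ℤ) 0 x → x.coeff 0 ≠ 0 →
      x ≠ 0 ∧ x.order = 0 := by
    intro x hx hx0
    have hne : x ≠ 0 := by rintro rfl; exact hx0 rfl
    refine ⟨hne, le_antisymm (HahnSeries.order_le_of_coeff_ne_zero hx0) ?_⟩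
    have := (weightGE_iff_le_order hn hne).1 hx
    nlinarith
  have h1w : WeightGE (n : ℤ) 0 (1 : LaurentSeries 𝕜) :=
    weightGE_zero_of_order_eq_zero hn HahnSeries.order_one
  have hc : (1 - A * C).coeff 0 = 1 := by
    rw [HahnSeries.coeff_sub, hAC 0 (by simpa using hn), HahnSeries.coeff_one, if_pos rfl, sub_zero]
  have hord : (1 - A * C).order = 0 := by
    refine (hunit ?_ (by rw [hc]; exact one_ne_zero)).2
    rw [sub_eq_add_neg]
    exact h1w.add (hAC.neg.mono hn.le)
  obtain ⟨u, hu, hu0, huo, huc⟩ := exists_sq_eq_of_order_eq_zero h2 hord one_ne_zero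
    (by rw [hc, one_pow])
  obtain ⟨hv0, hvo⟩ : 1 + u ≠ 0 ∧ (1 + u).order = 0 := by
    refine hunit (h1w.add (weightGE_zero_of_order_eq_zero hn huo)) ?_
    rw [HahnSeries.coeff_add, huc, HahnSeries.coeff_one, if_pos rfl, one_add_one_eq_two]
    exact h2
  have heq : 1 + -(A / (1 + u)) * C = u := by
    field_simp
    linear_combination -hu
  refine ⟨-(A / (1 + u)), ?_, ?_, by rwa [heq], by rwa [heq]⟩
  · simpa using (hA.div (m' := 0) hn hv0 (by rw [hvo, mul_zero])).neg
  · have h : (-(A / (1 + u))) ^ 2 * C = -(A / (1 + u)) * (u - 1) := by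
      linear_combination -(A / (1 + u)) * heq
    rw [h]
    field_simp
    ring

/-- A pivot of minimal weight can be split off. -/
lemma IsReduced.exists_of_pivot (h2 : (2 : 𝕜) ≠ 0) (hX : IsReduced X S m)
    {r p : Fin n} (hr : r ∉ S) (hp : p ∉ S) (h0 : X r p ≠ 0)
    (hm : n * (X r p).order = m - r - p) :
    ∃ Y, IwahoriCongr X Y ∧ Y.IsSymm ∧ ∃ S', S ⊂ S' ∧ MonomialOn Y S' := by
  have hn : (0 : ℤ) < n := by have := r.isLt; omega
  by_cases hrp : r = p
  · subst hrp
    obtain ⟨Y, h1, h3, h4⟩ := hX.exists_of_diagonal_pivot hr h0 hm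
    exact ⟨Y, h1, h3, _, Finset.ssubset_insert hr, h4⟩
  · obtain ⟨α, hα, hroot, hu0, huo⟩ := exists_quadratic_root h2 hrp
      (A := X r r / X r p) (C := X p p / X r p)
      (((hX.weight r hr r hr).div hn h0 hm).mono (by linarith))
      (((hX.weight p hp p hp).div hn h0 hm).mono (by linarith))
    obtain ⟨Y, hXY, hY, hYX⟩ := hX.exists_addColumn hp
      (α := fun q => if q = r then α else 0) (if_neg (Ne.symm hrp))
      (fun q hq => if_neg (by rintro rfl; exact hr hq)) (fun q => by
        split_ifs with h
        · rw [h]; exact hα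
        · exact WeightGE.zero)
    have hYrr : Y r r = 0 := by
      rw [hYX, if_pos rfl, hX.isSymm.apply r p]
      field_simp at hroot
      linear_combination hroot
    have hYrp : Y r p = X r p * (1 + α * (X p p / X r p)) := by
      rw [hYX, if_pos rfl, if_neg (Ne.symm hrp)]
      field_simp
      ring
    have hYm : n * (Y r p).order = m - r - p := by
      rw [hYrp, HahnSeries.order_mul h0 hu0, huo, add_zero, hm]
    obtain ⟨Z, hYZ, hZ, hZS⟩ := hY.exists_of_isotropic_pivot h2 hr hp hrp
      (by rw [hYrp]; exact mul_ne_zero h0 hu0) hYm hYrr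
    refine ⟨Z, hXY.trans hYZ, hZ, _, ?_, hZS⟩
    rw [Finset.insert_comm]
    exact Finset.ssubset_of_ssubset_of_subset (Finset.ssubset_insert hp)
      (Finset.insert_subset_insert _ (Finset.subset_insert _ _))

/-- Every non-degenerate symmetric matrix is congruent to a monomial one. The pivots are chosen
such that `n * v(X p q) + p + q` is minimal: the weights of the entries of one row are distinct
modulo `n`, so that a pivot clears its row by an element of the Iwahori order. -/
lemma exists_monomialOn_univ (h2 : (2 : 𝕜) ≠ 0) (X : Matrix (Fin n) (Fin n) (LaurentSeries 𝕜))
    (S : Finset (Fin n)) (hX : X.IsSymm) (hS : MonomialOn X S) (hdet : X.det ≠ 0) :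
    ∃ Y, IwahoriCongr X Y ∧ Y.IsSymm ∧ MonomialOn Y Finset.univ := by
  classical
  induction h : Sᶜ.card using Nat.strong_induction_on generalizing X S with
  | _ k ih =>
    by_cases hSu : S = Finset.univ
    · exact ⟨X, IwahoriCongr.refl X, hX, hSu ▸ hS⟩
    obtain ⟨a, ha⟩ : ∃ a, a ∉ S := by
      by_contra hc
      push Not at hc
      exact hSu (Finset.eq_univ_iff_forall.2 hc)
    have hn : (0 : ℤ) < n := by have := a.isLt; omega
    obtain ⟨c, hc⟩ : ∃ c, X a c ≠ 0 := by
      by_contra hc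
      push Not at hc
      exact hdet (Matrix.det_eq_zero_of_row_eq_zero a hc)
    have hcS : c ∉ S := fun h => hc (by rw [hX.apply, hS.apply_eq_zero h ha])
    obtain ⟨⟨r, p⟩, hrp, hmin⟩ := Finset.exists_min_image
      (Finset.univ.filter fun x : Fin n × Fin n => x.1 ∉ S ∧ x.2 ∉ S ∧ X x.1 x.2 ≠ 0)
      (fun x => (n : ℤ) * (X x.1 x.2).order + x.1 + x.2)
      ⟨(a, c), by simp [ha, hcS, hc]⟩
    simp only [Finset.mem_filter, Finset.mem_univ, true_and] at hrp hmin
    obtain ⟨hr, hp, h0⟩ := hrp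
    have hred : IsReduced X S ((n : ℤ) * (X r p).order + r + p) := by
      refine ⟨hX, hS, fun p' hp' q' hq' => ?_⟩
      by_cases hz : X p' q' = 0
      · rw [hz]; exact WeightGE.zero
      · rw [weightGE_iff_le_order hn hz]
        have := hmin (p', q') ⟨hp', hq', hz⟩
        simp only at this
        linarith
    obtain ⟨Y, hXY, hY, S', hSS', hS'⟩ := hred.exists_of_pivot h2 hr hp h0 (by ring)
    obtain ⟨Z, hYZ, hZ⟩ := ih S'ᶜ.card
      (h ▸ Finset.card_lt_card (Finset.compl_ssubset_compl.2 hSS')) Y S' hY hS'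
      (hXY.det_ne_zero hdet) rfl
    exact ⟨Z, hXY.trans hYZ, hZ⟩

lemma MonomialOn.isMonomial (hX : MonomialOn X Finset.univ) (hS : X.IsSymm) : IsMonomial X := by
  have h : ∀ p, ∃! q, X p q ≠ 0 := by
    intro p
    obtain ⟨q, -, h1, h2⟩ := hX p (Finset.mem_univ p)
    exact ⟨q, h1, fun r hr => by_contra fun hne => hr (h2 r hne)⟩
  refine ⟨h, fun q => ?_⟩
  simpa only [hS.apply] using h q

/-- A symmetric monomial matrix can be scaled by diagonal matrices of units so that its entries
become powers of `t` on the diagonal and `i` times powers of `t` off the diagonal. -/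
lemma exists_congr_affineMonomial (h2 : (2 : 𝕜) ≠ 0) (hsq : ∀ x : 𝕜, IsSquare x) {i : 𝕜}
    (hi : i ≠ 0) (hX : IsMonomial X) (hS : X.IsSymm) :
    ∃ (σ : Equiv.Perm (Fin n)) (c : Fin n → ℤ), (∀ q, σ (σ q) = q) ∧
      IwahoriCongr X (affineMonomial σ c fun q => if σ q = q then 1 else i) := by
  obtain ⟨σ, hσ, hsupp⟩ := exists_perm_of_isMonomial hX hS
  have h0 : ∀ q, X (σ q) q ≠ 0 := fun q => (hsupp _ _).2 rfl
  have hsymm : ∀ q, X (σ (σ q)) (σ q) = X (σ q) q := fun q => by rw [hσ, hS.apply]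
  set c : Fin n → ℤ := fun q => (X (σ q) q).order with hc
  have hcσ : ∀ q, c (σ q) = c q := fun q => by simp only [hc, hsymm]
  have hquot : ∀ q, tpow 𝕜 (c q) / X (σ q) q ≠ 0 ∧ (tpow 𝕜 (c q) / X (σ q) q).order = 0 := by
    intro q
    refine ⟨div_ne_zero (tpow_ne_zero _) (h0 q), ?_⟩
    rw [order_div (tpow_ne_zero _) (h0 q), tpow, HahnSeries.order_single one_ne_zero]
    exact sub_self _
  choose v hv hv0 hvo using fun q => exists_sq_eq_of_isSquare h2 hsq (hquot q).1 (hquot q).2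
  set d : Fin n → LaurentSeries 𝕜 := fun q => if σ q = q then v q
    else if q < σ q then HahnSeries.C i * (tpow 𝕜 (c q) / X (σ q) q) else 1 with hd
  have hCi : (HahnSeries.C i : LaurentSeries 𝕜) ≠ 0 := HahnSeries.C_ne_zero hi
  have hd0 : ∀ q, d q ≠ 0 := by
    intro q
    simp only [hd]
    split_ifs
    · exact hv0 q
    · exact mul_ne_zero hCi (hquot q).1
    · exact one_ne_zero
  have hdo : ∀ q, (d q).order = 0 := by
    intro q
    simp only [hd]
    split_ifs
    · exact hvo q
    · rw [HahnSeries.order_mul hCi (hquot q).1, (hquot q).2, HahnSeries.order_C, add_zero]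
    · exact HahnSeries.order_one
  refine ⟨σ, c, hσ, Matrix.diagonal d, isIwahoriUnit_diagonal hd0 hdo, ?_⟩
  ext1 p q
  rw [Matrix.diagonal_transpose, Matrix.mul_diagonal, Matrix.diagonal_mul, affineMonomial_apply]
  by_cases hpq : p = σ q
  · subst hpq
    rw [if_pos rfl, ← C_mul_tpow]
    have hX0 := h0 q
    by_cases hq : σ q = q
    · have hvq := hv q
      rw [eq_div_iff hX0] at hvq
      simp only [hd, hq, if_true]
      rw [map_one, one_mul, ← hvq, hq]
      ring
    · simp only [hd, hσ, if_neg hq, if_neg (Ne.symm hq), hcσ]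
      have hXs : X q (σ q) = X (σ q) q := hS.apply _ _
      rcases lt_or_gt_of_ne hq with h | h
      · rw [if_pos h, if_neg h.asymm, hXs]
        field_simp
      · rw [if_neg h.asymm, if_pos h]
        field_simp
  · rw [if_neg hpq]
    have : X p q = 0 := by
      by_contra hne
      exact hpq ((hsupp p q).1 hne)
    rw [this, mul_zero, zero_mul]

end Reduction

open AffineTwistedInvolution

/-- Every double coset is represented in `iSymAPM`. -/
lemma exists_mem_iSymAPM {n : ℕ} [NeZero n] {𝕜 : Type*} [Field 𝕜] (h2 : (2 : 𝕜) ≠ 0)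
    (hsq : ∀ x : 𝕜, IsSquare x) {i : 𝕜} (hi : i ^ 2 = -1)
    (x : Matrix.SpecialLinearGroup (Fin n) (LaurentSeries 𝕜)) (hx : x.1.IsSymm) :
    ∃ b ∈ iwahori n 𝕜, ∃ h ∈ iSymAPM n i, b.1ᵀ * x.1 * b.1 = h.1 := by
  have hi0 : i ≠ 0 := by rintro rfl; norm_num at hi
  obtain ⟨s, hs⟩ := exists_sq_eq_tpow_sub_one h2 hi
  obtain ⟨Y, hxY, hYS, hYM⟩ := exists_monomialOn_univ h2 x.1 ∅ hx (fun p hp => by simp at hp)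
    (by rw [x.2]; exact one_ne_zero)
  obtain ⟨σ, c, hσ, hYZ⟩ := exists_congr_affineMonomial h2 hsq hi0 (hYM.isMonomial hYS) hYS
  obtain ⟨b, hb, hZ⟩ := hxY.trans hYZ
  have hκ : ∀ q, (if σ q = q then 1 else i) ≠ 0 := fun q => by split_ifs <;> simp [hi0]
  have hZdet : (affineMonomial σ c fun q => if σ q = q then 1 else i).det = b.det * b.det := by
    rw [hZ, Matrix.det_mul, Matrix.det_mul, Matrix.det_transpose, x.2, mul_one]
  have hZS : (affineMonomial σ c fun q => if σ q = q then 1 else i).IsSymm := by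
    rw [hZ, Matrix.IsSymm, Matrix.transpose_mul, Matrix.transpose_mul, hx,
      Matrix.transpose_transpose, Matrix.mul_assoc]
  obtain ⟨w, rfl, rfl⟩ := exists_of_det hκ hσ hZS
    (by rw [hZdet, HahnSeries.order_mul hb.2.1 hb.2.1, hb.2.2, add_zero])
  have hw : bᵀ * x.1 * b = w.hMat i := hZ.symm.trans (hMat_eq i w).symm
  have hwdet : (w.hMat i).det = 1 := by
    rw [← gMat_transpose_mul_self h2 hi hs w, Matrix.det_mul, Matrix.det_transpose,
      det_gMat h2 hi hs, mul_one]
  have hbdet : b.det * b.det = 1 := by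
    rw [← hw, Matrix.det_mul, Matrix.det_mul, Matrix.det_transpose, x.2, mul_one] at hwdet
    exact hwdet
  rcases mul_self_eq_one_iff.1 hbdet with h1 | h1
  · exact ⟨⟨b, h1⟩, mem_iwahori_of_inIwahoriOrder hb.1, ⟨w.hMat i, hwdet⟩,
      mem_iSymAPM_of_eq_hMat hi0 rfl, hw⟩
  -- the sign of `b` is corrected at a fixed point of `w`, which leaves `h_w` unchanged, or else at
  -- the first index, which turns `h_w⁺` into `h_w⁻`
  have hflip : ∀ j₀ : Fin n,
      IsIwahoriUnit (b * Matrix.diagonal fun j => if j = j₀ then -1 else 1) ∧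
      (b * Matrix.diagonal fun j => if j = j₀ then -1 else 1).det = 1 ∧
      (b * Matrix.diagonal fun j => if j = j₀ then -1 else 1)ᵀ * x.1 *
        (b * Matrix.diagonal fun j => if j = j₀ then -1 else 1) =
      (Matrix.diagonal fun j => if j = j₀ then -1 else 1) * w.hMat i *
        Matrix.diagonal fun j => if j = j₀ then -1 else 1 := by
    intro j₀
    refine ⟨hb.mul (isIwahoriUnit_diagonal (fun j => ?_) fun j => ?_), ?_, ?_⟩
    · split_ifs <;> simp
    · split_ifs <;> simp
    · rw [Matrix.det_mul, h1, Matrix.det_diagonal]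
      simp [Finset.prod_ite_eq']
    · rw [← hw, Matrix.transpose_mul, Matrix.diagonal_transpose]
      simp only [Matrix.mul_assoc]
  by_cases hf : w.FixedPointFree
  · obtain ⟨hu, hd, heq⟩ := hflip 0
    have hm : (w.hMinus i).det = 1 := by
      rw [hMinus, ← heq, Matrix.det_mul, Matrix.det_mul, Matrix.det_transpose, hd, x.2]
      simp
    exact ⟨⟨_, hd⟩, mem_iwahori_of_inIwahoriOrder hu.1, ⟨w.hMinus i, hm⟩,
      mem_iSymAPM_of_eq_hMinus hi0 hf rfl, heq⟩
  · obtain ⟨j₀, hj⟩ : ∃ j, w.perm j = j := by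
      by_contra hc
      push Not at hc
      exact hf hc
    obtain ⟨hu, hd, heq⟩ := hflip j₀
    refine ⟨⟨_, hd⟩, mem_iwahori_of_inIwahoriOrder hu.1, ⟨w.hMat i, hwdet⟩,
      mem_iSymAPM_of_eq_hMat hi0 rfl, heq.trans ?_⟩
    ext1 p q
    change _ = w.hMat i p q
    rw [Matrix.mul_diagonal, Matrix.diagonal_mul]
    by_cases hpq : p = w.perm q
    · have hiff : p = j₀ ↔ q = j₀ := by
        rw [hpq, ← w.perm.injective.eq_iff (a := q), hj]
      simp only [hiff]
      split_ifs <;> simp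
    · rw [hMat, Matrix.of_apply, if_neg hpq]
      simp

/-! ### The parametrization of the double cosets -/

section Parametrization

open AffineTwistedInvolution

variable {n : ℕ} [NeZero n] {𝕜 : Type*} [Field 𝕜] {i : 𝕜}

lemma eq_of_congr_of_mem_iSymAPM (h2 : (2 : 𝕜) ≠ 0) (hi : i ≠ 0)
    {h h' b : Matrix.SpecialLinearGroup (Fin n) (LaurentSeries 𝕜)} (hh : h ∈ iSymAPM n i)
    (hh' : h' ∈ iSymAPM n i) (hb : b ∈ iwahori n 𝕜) (heq : b.1ᵀ * h.1 * b.1 = h'.1) : h = h' := by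
  obtain ⟨w, hw | ⟨hf, hw⟩⟩ := (mem_iSymAPM_iff hi h).1 hh <;>
    obtain ⟨w', hw' | ⟨hf', hw'⟩⟩ := (mem_iSymAPM_iff hi h').1 hh'
  · rw [hw, hw'] at heq
    exact Subtype.ext (by rw [hw, hw', eq_of_congr_hMat hi hb heq])
  · rw [hw, hw'] at heq
    exact absurd heq (congr_hMat_ne_hMinus h2 hi hf' hb)
  · have hinv : b.1 * (b⁻¹).1 = 1 := congrArg Subtype.val (mul_inv_cancel b)
    have hinv' : (b⁻¹).1ᵀ * b.1ᵀ = 1 := by rw [← Matrix.transpose_mul, hinv, Matrix.transpose_one]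
    refine absurd ?_ (congr_hMat_ne_hMinus (w := w') h2 hi hf (inv_mem hb))
    rw [← hw, ← hw', ← heq]
    calc (b⁻¹).1ᵀ * (b.1ᵀ * h.1 * b.1) * (b⁻¹).1
        = ((b⁻¹).1ᵀ * b.1ᵀ) * h.1 * (b.1 * (b⁻¹).1) := by simp only [Matrix.mul_assoc]
      _ = h.1 := by rw [hinv, hinv', Matrix.one_mul, Matrix.mul_one]
  · rw [hw, hw'] at heq
    exact Subtype.ext (by rw [hw, hw', eq_of_congr_hMinus hi hb heq])

/-- The double coset of `g` determines `gᵀ g`, provided that this lies in `iSymAPM`. -/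
lemma transpose_mul_eq_of_orbit_eq (h2 : (2 : 𝕜) ≠ 0) (hi : i ≠ 0)
    {g g' h h' : Matrix.SpecialLinearGroup (Fin n) (LaurentSeries 𝕜)} (hh : h ∈ iSymAPM n i)
    (hh' : h' ∈ iSymAPM n i) (hg : g.transpose * g = h) (hg' : g'.transpose * g' = h')
    (ho : orbit g = orbit g') : h = h' := by
  obtain ⟨b, hb, heq⟩ := (orbit_eq_iff g g').1 ho
  refine eq_of_congr_of_mem_iSymAPM h2 hi hh hh' hb ?_
  rw [← hg, ← hg']
  exact heq

lemma exists_orbit_eq (h2 : (2 : 𝕜) ≠ 0) (hsq : ∀ x : 𝕜, IsSquare x) (hi : i ^ 2 = -1)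
    (O : Orbits n 𝕜) : ∃ g : Matrix.SpecialLinearGroup (Fin n) (LaurentSeries 𝕜),
      orbit g = O ∧ g.transpose * g ∈ iSymAPM n i := by
  obtain ⟨g₀, rfl⟩ : ∃ g₀, orbit g₀ = O := Quotient.exists_rep O
  obtain ⟨b, hb, h, hh, heq⟩ := exists_mem_iSymAPM h2 hsq hi (g₀.transpose * g₀) (by
    change (g₀.1ᵀ * g₀.1)ᵀ = g₀.1ᵀ * g₀.1
    rw [Matrix.transpose_mul, Matrix.transpose_transpose])
  have hval : (g₀ * b).1ᵀ * (g₀ * b).1 = b.1ᵀ * (g₀.1ᵀ * g₀.1) * b.1 := by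
    change (g₀.1 * b.1)ᵀ * (g₀.1 * b.1) = _
    rw [Matrix.transpose_mul]
    simp only [Matrix.mul_assoc]
  refine ⟨g₀ * b, ((orbit_eq_iff _ _).2 ⟨b, hb, hval.symm⟩).symm, ?_⟩
  rwa [show (g₀ * b).transpose * (g₀ * b) = h from Subtype.ext (hval.trans heq)]

/-- An element `h` of `iSymAPM` determines the `w` with `h = h_w` or `h = h_w⁻`, so that the
representative `g_h` is well defined. -/
lemma exists_representative (h2 : (2 : 𝕜) ≠ 0) (hi : i ^ 2 = -1) {s : LaurentSeries 𝕜}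
    (hs : s ^ 2 = tpow 𝕜 1 - 1) {h : Matrix.SpecialLinearGroup (Fin n) (LaurentSeries 𝕜)}
    (hh : h ∈ iSymAPM n i) :
    ∃ g : Matrix.SpecialLinearGroup (Fin n) (LaurentSeries 𝕜),
      (∀ w : AffineTwistedInvolution n, (h.1 = w.hMat i → g.1 = w.gMat i s) ∧
        (w.FixedPointFree → h.1 = w.hMinus i → g.1 = w.gMinus i s)) ∧
      g.transpose * g = h := by
  have hi0 : i ≠ 0 := by rintro rfl; norm_num at hi
  obtain ⟨w, hw | ⟨hf, hw⟩⟩ := (mem_iSymAPM_iff hi0 h).1 hh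
  · refine ⟨⟨w.gMat i s, det_gMat h2 hi hs w⟩, fun w' => ⟨fun hw' => ?_, fun hf' hw' => ?_⟩,
      Subtype.ext ((gMat_transpose_mul_self h2 hi hs w).trans hw.symm)⟩
    · rw [hMat_injective hi0 (hw.symm.trans hw')]
    · exact absurd (hw.symm.trans hw') (hMat_ne_hMinus h2 hi0 hf')
  · refine ⟨⟨w.gMinus i s, det_gMinus h2 hi hs hf⟩, fun w' => ⟨fun hw' => ?_, fun hf' hw' => ?_⟩,
      Subtype.ext ((gMinus_transpose_mul_self h2 hi hs hf).trans hw.symm)⟩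
    · exact absurd (hw'.symm.trans hw) (hMat_ne_hMinus h2 hi0 hf)
    · exact congrArg (fun w => w.gMinus i s) (hMinus_injective hi0 (hw.symm.trans hw'))

end Parametrization

end AffineSO

end

theorem mainTheorem2 {𝕜 : Type*} [Field 𝕜] (hchar : (2 : 𝕜) ≠ 0) (hsq : ∀ x : 𝕜, IsSquare x)
    (i : 𝕜) (hi : i ^ 2 = -1) (n : ℕ) [NeZero n] :
    -- every double coset contains a solution of `gᵀ g = w` for a unique `w` in `iSymAPM`
    (∀ O : AffineSO.Orbits n 𝕜,
      ∃! w : Matrix.SpecialLinearGroup (Fin n) (LaurentSeries 𝕜), w ∈ AffineSO.iSymAPM n i ∧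
        ∃ g : Matrix.SpecialLinearGroup (Fin n) (LaurentSeries 𝕜),
          AffineSO.orbit g = O ∧ g.transpose * g = w) ∧
    -- for every `w` in `iSymAPM` solutions exist, and they lie in a single double coset
    (∀ w ∈ AffineSO.iSymAPM n i,
      (∃ g : Matrix.SpecialLinearGroup (Fin n) (LaurentSeries 𝕜), g.transpose * g = w) ∧
      ∀ g g' : Matrix.SpecialLinearGroup (Fin n) (LaurentSeries 𝕜),
        g.transpose * g = w → g'.transpose * g' = w →
          AffineSO.orbit g = AffineSO.orbit g') ∧
    -- `iSymAPM` consists exactly of the `h_w` and, for `w` fixed-point-free, the `h_w⁻`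
    (∀ h : Matrix.SpecialLinearGroup (Fin n) (LaurentSeries 𝕜), h ∈ AffineSO.iSymAPM n i ↔
      ∃ w : AffineSO.AffineTwistedInvolution n,
        (h : Matrix (Fin n) (Fin n) (LaurentSeries 𝕜)) = w.hMat i ∨
        (w.FixedPointFree ∧ (h : Matrix (Fin n) (Fin n) (LaurentSeries 𝕜)) = w.hMinus i)) ∧
    -- a fixed-point-free `w` gives two distinct elements of `iSymAPM` and two distinct orbits
    (∀ w : AffineSO.AffineTwistedInvolution n, w.FixedPointFree →
      ∃ hp ∈ AffineSO.iSymAPM n i, ∃ hm ∈ AffineSO.iSymAPM n i,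
        (hp : Matrix (Fin n) (Fin n) (LaurentSeries 𝕜)) = w.hMat i ∧
        (hm : Matrix (Fin n) (Fin n) (LaurentSeries 𝕜)) = w.hMinus i ∧
        hp ≠ hm ∧
        ∀ g g' : Matrix.SpecialLinearGroup (Fin n) (LaurentSeries 𝕜),
          g.transpose * g = hp → g'.transpose * g' = hm →
            AffineSO.orbit g ≠ AffineSO.orbit g') ∧
    -- the explicit representatives `g_w`, `g_w⁺`, `g_w⁻` give the bijection `w ↦ K g_w B`
    (∃ s : LaurentSeries 𝕜, s ^ 2 = AffineSO.tpow 𝕜 1 - 1) ∧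
    (∀ s : LaurentSeries 𝕜, s ^ 2 = AffineSO.tpow 𝕜 1 - 1 →
      ∃ g : AffineSO.iSymAPM n i → Matrix.SpecialLinearGroup (Fin n) (LaurentSeries 𝕜),
        (∀ (w : AffineSO.AffineTwistedInvolution n) (h : AffineSO.iSymAPM n i),
          ((h.1 : Matrix (Fin n) (Fin n) (LaurentSeries 𝕜)) = w.hMat i →
            (g h : Matrix (Fin n) (Fin n) (LaurentSeries 𝕜)) = w.gMat i s) ∧
          (w.FixedPointFree → (h.1 : Matrix (Fin n) (Fin n) (LaurentSeries 𝕜)) = w.hMinus i →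
            (g h : Matrix (Fin n) (Fin n) (LaurentSeries 𝕜)) = w.gMinus i s)) ∧
        (∀ h : AffineSO.iSymAPM n i, (g h).transpose * g h = h.1) ∧
        Function.Bijective fun h : AffineSO.iSymAPM n i => AffineSO.orbit (g h)) := by

  have hi0 : i ≠ 0 := by rintro rfl; norm_num at hi
  obtain ⟨s₀, hs₀⟩ := AffineSO.exists_sq_eq_tpow_sub_one hchar hi
  refine ⟨fun O => ?_, fun w hw => ⟨?_, fun g g' hg hg' => ?_⟩, AffineSO.mem_iSymAPM_iff hi0,
    fun w hf => ?_, ⟨s₀, hs₀⟩, fun s hs => ?_⟩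
  · obtain ⟨g, hg, hgw⟩ := AffineSO.exists_orbit_eq hchar hsq hi O
    refine ⟨_, ⟨hgw, g, hg, rfl⟩, ?_⟩
    rintro w ⟨hw, g', hg', hgw'⟩
    exact AffineSO.transpose_mul_eq_of_orbit_eq hchar hi0 hw hgw hgw' rfl (hg'.trans hg.symm)
  · obtain ⟨g, -, hg⟩ := AffineSO.exists_representative hchar hi hs₀ hw
    exact ⟨g, hg⟩
  · exact AffineSO.orbit_eq_of_transpose_mul_eq (hg.trans hg'.symm)
  · have hp : (w.hMat i).det = 1 := by
      rw [← AffineSO.AffineTwistedInvolution.gMat_transpose_mul_self hchar hi hs₀ w,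
        Matrix.det_mul, Matrix.det_transpose,
        AffineSO.AffineTwistedInvolution.det_gMat hchar hi hs₀, mul_one]
    have hm : (w.hMinus i).det = 1 := by
      rw [← AffineSO.AffineTwistedInvolution.gMinus_transpose_mul_self hchar hi hs₀ hf,
        Matrix.det_mul, Matrix.det_transpose,
        AffineSO.AffineTwistedInvolution.det_gMinus hchar hi hs₀ hf, mul_one]
    have hpm := AffineSO.mem_iSymAPM_of_eq_hMat (h := ⟨w.hMat i, hp⟩) hi0 rfl
    have hmm := AffineSO.mem_iSymAPM_of_eq_hMinus (h := ⟨w.hMinus i, hm⟩) hi0 hf rfl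
    have hne : (⟨w.hMat i, hp⟩ : Matrix.SpecialLinearGroup (Fin n) (LaurentSeries 𝕜)) ≠
        ⟨w.hMinus i, hm⟩ := fun h =>
      AffineSO.AffineTwistedInvolution.hMat_ne_hMinus hchar hi0 hf (congrArg Subtype.val h)
    exact ⟨_, hpm, _, hmm, rfl, rfl, hne, fun g g' hg hg' ho =>
      hne (AffineSO.transpose_mul_eq_of_orbit_eq hchar hi0 hpm hmm hg hg' ho)⟩
  · choose g hg hgh using fun h : AffineSO.iSymAPM n i =>
      AffineSO.exists_representative hchar hi hs h.2
    refine ⟨g, fun w h => hg h w, hgh, fun h h' ho => Subtype.ext ?_, fun O => ?_⟩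
    · exact AffineSO.transpose_mul_eq_of_orbit_eq hchar hi0 h.2 h'.2 (hgh h) (hgh h') ho
    · obtain ⟨g', rfl, hg'⟩ := AffineSO.exists_orbit_eq hchar hsq hi O
      exact ⟨⟨_, hg'⟩, AffineSO.orbit_eq_of_transpose_mul_eq (hgh ⟨_, hg'⟩)⟩
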